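/- Let $\gamma_n$ be the standard Gaussian measure on $\mathbb{R}^n$. A \emph{partition} of $\mathbb{R}^n$ is a family of measurable sets $\{A_p\}_{p=1}^{n+1}$ with $\bigcup_p A_p=\mathbb{R}^n$ and $\gamma_n(A_p\cap A_q)=0$ for $p\ne q$; its \emph{volumes} are $a=(a_1,\dots,a_{n+1})$, $a_p=\gamma_n(A_p)$. For $\rho\in(-1,1)$ let $$T_\rho f(x)=\int_{\mathbb{R}^n} f\big(\rho x+\sqrt{1-\rho^2}\,z\big)\,d\gamma_n(z),\qquad S_\rho(\{A_p\})=\sum_{p=1}^{n+1}\int_{\mathbb{R}^n}1_{A_p}\,T_\rho 1_{A_p}\,d\gamma_n .$$ A partition is \emph{flat} if there are $y\in\mathbb{R}^n$ and $y_1,\dots,y_{n+1}\in\mathbb{R}^n\setminus\{0\}$, no $y_p$ being a positive multiple of $y_q$ for $p\neq q$, such that $A_p=y+\{x:\langle x,y_p\rangle=\max_q\langle x,y_q\rangle\}$ for all $p$. \textbf{Assumption (G).} The partition $\{A_p\}_{p=1}^{n+1}$ is flat, and for some $i\neq j$ the sets $A_i,A_j$ share a common facet and there are a unit vector $N\in\mathbb{R}^n$,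 $c\in\mathbb{R}$ and $w\in\mathbb{R}^n\setminus\{0\}$ such that, with $\Pi=\{x:\langle x,N\rangle=c\}$: $A_i\cap A_j\subset\Pi$; $A_i\subset\{x:\langle x,N\rangle\le c\}$; the line $L=\{cN+tw:t\in\mathbb{R}\}$ is contained in $\Pi$ and meets the relative interior of $A_i\cap A_j$; and $\{cN+tw:t\ge 1\}\subset A_i\cap A_j$. (In particular $n\ge2$.) \textbf{Corollary (Biased Optimizers are not Flat).} Let $\{A_p\}_{p=1}^{n+1}$ be a partition of $\mathbb{R}^n$ with volumes $a=(a_1,\dots,a_{n+1})$, where $a_p>0$ for all $p$. \begin{itemize} \item[(1)] Let $\rho\in(0,1)$ and suppose that $S_\rho(\{A_p\})=\sup S_\rho(\{B_p\})$, the supremum being over all partitions $\{B_p\}_{p=1}^{n+1}$ of $\mathbb{R}^n$ with volumes $a$. If Assumption (G) holds, then $a=(1/(n+1),\dots,1/(n+1))$. \item[(2)] Let $\rho\in(-1,0)$ and suppose that $S_\rho(\{A_p\})=\inf S_\rho(\{B_p\})$, the infimum being over all partitions $\{B_p\}_{p=1}^{n+1}$ of $\mathbb{R}^n$ with volumes $a$.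 If Assumption (G) holds, then $a=(1/(n+1),\dots,1/(n+1))$. \end{itemize} -/

import Mathlib

open MeasureTheory ProbabilityTheory

namespace NoiseStability

/-- The Ornstein-Uhlenbeck operator
`T_ρ f (x) = ∫ f (ρ x + √(1 - ρ²) z) dγ_n(z)`, where `γ_n` is the standard Gaussian measure. -/
noncomputable def ornsteinUhlenbeck {n : ℕ} (ρ : ℝ) (f : EuclideanSpace ℝ (Fin n) → ℝ)
    (x : EuclideanSpace ℝ (Fin n)) : ℝ :=
  ∫ z, f (ρ • x + Real.sqrt (1 - ρ ^ 2) • z) ∂(stdGaussian (EuclideanSpace ℝ (Fin n)))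

/-- A partition of `ℝⁿ` into `k` measurable parts, up to overlaps of Gaussian measure zero. -/
structure IsPartition {n k : ℕ} (A : Fin k → Set (EuclideanSpace ℝ (Fin n))) : Prop where
  measurable : ∀ i, MeasurableSet (A i)
  cover : ⋃ i, A i = Set.univ
  overlap : ∀ i j, i ≠ j → stdGaussian (EuclideanSpace ℝ (Fin n)) (A i ∩ A j) = 0

/-- The parts `A i` have Gaussian volumes `a i`. -/
def HasVolumes {n k : ℕ} (A : Fin k → Set (EuclideanSpace ℝ (Fin n))) (a : Fin k → ℝ) : Prop :=
  ∀ i, (stdGaussian (EuclideanSpace ℝ (Fin n))).real (A i) = a i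

/-- The Gaussian noise stability `S_ρ(A) = ∑ i, ∫ 1_{A i} T_ρ 1_{A i} dγ_n`. -/
noncomputable def noiseStability {n k : ℕ} (ρ : ℝ)
    (A : Fin k → Set (EuclideanSpace ℝ (Fin n))) : ℝ :=
  ∑ i, ∫ x, (A i).indicator (fun _ => (1 : ℝ)) x *
    ornsteinUhlenbeck ρ ((A i).indicator (fun _ => (1 : ℝ))) x
      ∂(stdGaussian (EuclideanSpace ℝ (Fin n)))

/-- The noise stabilities of all partitions of `ℝⁿ` with volumes `a`. -/
def stabilityValues (n : ℕ) {k : ℕ} (ρ : ℝ) (a : Fin k → ℝ) : Set ℝ :=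
  {s | ∃ B : Fin k → Set (EuclideanSpace ℝ (Fin n)),
    IsPartition B ∧ HasVolumes B a ∧ noiseStability ρ B = s}

/-- A flat partition: `A i = y + {x | ⟨x, v i⟩ = max_j ⟨x, v j⟩}` for nonzero vectors `v i`,
none of which is a positive multiple of another. -/
def IsFlatPartition {n k : ℕ} (A : Fin k → Set (EuclideanSpace ℝ (Fin n))) : Prop :=
  IsPartition A ∧
    ∃ (y : EuclideanSpace ℝ (Fin n)) (v : Fin k → EuclideanSpace ℝ (Fin n)),
      (∀ i, v i ≠ 0) ∧
      (∀ i j, i ≠ j → ¬ ∃ t : ℝ, 0 < t ∧ v i = t • v j) ∧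
      ∀ i, A i = (fun x => y + x) ''
        {x | ∀ j, inner ℝ x (v j) ≤ inner ℝ x (v i)}

/-- `F` is a facet of the polyhedral set `P`: a nonempty (exposed) face whose dimension is one
less than that of `P`. -/
def IsFacet {n : ℕ} (P F : Set (EuclideanSpace ℝ (Fin n))) : Prop :=
  F.Nonempty ∧ IsExposed ℝ P F ∧
    Module.finrank ℝ (vectorSpan ℝ F) + 1 = Module.finrank ℝ (vectorSpan ℝ P)

/-- The geometric assumptions: the partition is flat, `A i` and `A j` share a facet, their
intersection lies in the hyperplane `{x | ⟨x, N⟩ = c}` with unit normal `N`, the part `A i` is on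
the side `⟨x, N⟩ ≤ c`, and `{c N + t w | t ∈ ℝ}` is an infinite line in that hyperplane which
meets the relative interior of `A i ∩ A j` and whose half `t ≥ 1` lies in `A i ∩ A j`. -/
structure GeometricAssumption {n k : ℕ} (A : Fin k → Set (EuclideanSpace ℝ (Fin n)))
    (i j : Fin k) (N : EuclideanSpace ℝ (Fin n)) (c : ℝ)
    (w : EuclideanSpace ℝ (Fin n)) : Prop where
  flat : IsFlatPartition A
  ne : i ≠ j
  norm_normal : ‖N‖ = 1
  inter_subset : A i ∩ A j ⊆ {x | inner ℝ x N = c}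
  common_facet : ∃ F, IsFacet (A i) F ∧ IsFacet (A j) F
  side : A i ⊆ {x | inner ℝ x N ≤ c}
  direction_ne : w ≠ 0
  line_subset : ∀ t : ℝ, inner ℝ (c • N + t • w) N = c
  line_meets : ∃ t : ℝ, c • N + t • w ∈ intrinsicInterior ℝ (A i ∩ A j)
  ray_subset : ∀ t : ℝ, 1 ≤ t → c • N + t • w ∈ A i ∩ A j

end NoiseStability

/-! Write the flat partition as the maximality cones, with apex `y`, of functionals `v i`. Swapping
small equal masses between parts `i` and `j` changes the stability to first order by the difference
of `T_ρ (1_{A i} - 1_{A j})` at the two places, so at a maximum or a minimum this gap is constant on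
`A i ∩ A j` (`exists_variation`).

If `A i` and `A j` are adjacent, their interface contains a ray `y + s z₀`, `s ≥ 0`, on which every
other functional is strictly smaller. By Cameron-Martin the gap is analytic along the line, hence
constant on all of it. Far out one way both parts disappear, so the constant is 0; far out the other
way they become complementary half-spaces, which must then have equal mass as seen from `ρ y`. As `ρ
≠ 1`, this forces `⟪y, v i⟫ = ⟪y, v j⟫` (`IsMaxPartition.adjacent_eq`).

All volumes are positive, so any two cells are joined by a chain of adjacent ones
(`eq_of_adjacent_eq`). Thus neither `T_ρ 1_{A i} (y)` nor `⟪y, v i⟫` depends on `i`. The second fact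
makes each part a cone with apex at the origin, unchanged by translation by `y`, so `T_ρ 1_{A i}
(y)` is the volume `a i`, and the volumes agree. -/

open scoped RealInnerProductSpace Topology ENNReal

namespace NoiseStability

/-! ### Standard Gaussian measure: Cameron-Martin, analyticity, exchangeability -/

section Gaussian

variable {ι : Type*} [Fintype ι]

instance isOpenPosMeasure_stdGaussian :
    (stdGaussian (EuclideanSpace ℝ ι)).IsOpenPosMeasure := by
  rw [← map_pi_eq_stdGaussian]
  have : (gaussianReal 0 1).IsOpenPosMeasure :=
    (gaussianReal_absolutelyContinuous' 0 one_ne_zero).isOpenPosMeasure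
  exact (PiLp.continuous_toLp 2 _).isOpenPosMeasure_map (WithLp.toLp_surjective 2)

theorem map_inner_stdGaussian (d : EuclideanSpace ℝ ι) :
    (stdGaussian (EuclideanSpace ℝ ι)).map (fun x => ⟪d, x⟫) =
      gaussianReal 0 (‖d‖ ^ 2).toNNReal := by
  have h := IsGaussian.map_eq_gaussianReal (μ := stdGaussian (EuclideanSpace ℝ ι)) (innerSL ℝ d)
  rw [integral_strongDual_stdGaussian, variance_dual_stdGaussian, innerSL_apply_norm] at h
  exact h

theorem stdGaussian_hyperplane {d : EuclideanSpace ℝ ι} (hd : d ≠ 0) (c : ℝ) :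
    stdGaussian (EuclideanSpace ℝ ι) {x | ⟪d, x⟫ = c} = 0 := by
  have hv : (‖d‖ ^ 2).toNNReal ≠ 0 := by
    have : 0 < ‖d‖ := norm_pos_iff.2 hd
    simp only [ne_eq, Real.toNNReal_eq_zero, not_le]; positivity
  have := nullSingletonClass_gaussianReal (μ := 0) hv
  have h : (stdGaussian (EuclideanSpace ℝ ι)).map (fun x => ⟪d, x⟫) {c} = 0 := by
    rw [map_inner_stdGaussian]; exact measure_singleton c
  rwa [Measure.map_apply (by fun_prop) (measurableSet_singleton c)] at h

theorem stdGaussian_singleton [Nonempty ι] (c : EuclideanSpace ℝ ι) :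
    stdGaussian (EuclideanSpace ℝ ι) {c} = 0 := by
  obtain ⟨d, hd⟩ := exists_ne (0 : EuclideanSpace ℝ ι)
  refine measure_mono_null ?_ (stdGaussian_hyperplane hd ⟪d, c⟫)
  rintro _ rfl
  rfl

theorem map_neg_stdGaussian :
    (stdGaussian (EuclideanSpace ℝ ι)).map (fun x => -x) = stdGaussian (EuclideanSpace ℝ ι) :=
  stdGaussian_map (LinearIsometryEquiv.neg ℝ)

theorem integrable_exp_inner_stdGaussian (m : EuclideanSpace ℝ ι) :
    Integrable (fun x => Real.exp ⟪m, x⟫) (stdGaussian (EuclideanSpace ℝ ι)) := by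
  have h := integrable_exp_mul_gaussianReal (μ := 0) (v := (‖m‖ ^ 2).toNNReal) 1
  rw [← map_inner_stdGaussian, integrable_map_measure (by fun_prop) (by fun_prop)] at h
  simpa [Function.comp_def] using h

theorem integral_exp_inner_stdGaussian (m : EuclideanSpace ℝ ι) :
    ∫ x, Real.exp ⟪m, x⟫ ∂(stdGaussian (EuclideanSpace ℝ ι)) = Real.exp (‖m‖ ^ 2 / 2) := by
  have h := mgf_gaussianReal (map_inner_stdGaussian m) 1
  simpa [mgf, Real.coe_toNNReal _ (sq_nonneg ‖m‖)] using h

/-- The integral factors over coordinates into one-dimensional Gaussian moment generating functions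
at the complex points `m k + i t k`. -/
theorem integral_cexp_stdGaussian (m t : EuclideanSpace ℝ ι) :
    ∫ x, Complex.exp (⟪m, x⟫ + ⟪x, t⟫ * Complex.I) ∂(stdGaussian (EuclideanSpace ℝ ι)) =
      Complex.exp (‖m‖ ^ 2 / 2 + ⟪m, t⟫ * Complex.I - ‖t‖ ^ 2 / 2) := by
  rw [← map_pi_eq_stdGaussian, integral_map (by fun_prop) (by fun_prop)]
  have h1 : ∀ x : ι → ℝ, Complex.exp (⟪m, WithLp.toLp 2 x⟫ + ⟪WithLp.toLp 2 x, t⟫ * Complex.I) =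
      ∏ k, Complex.exp ((m k + t k * Complex.I) * x k) := by
    intro x
    rw [← Complex.exp_sum]
    congr 1
    simp only [PiLp.inner_apply, RCLike.inner_apply, conj_trivial, Complex.ofReal_sum,
      Complex.ofReal_mul, Finset.sum_mul, ← Finset.sum_add_distrib]
    exact Finset.sum_congr rfl fun k _ => by ring
  simp_rw [h1]
  rw [integral_fintype_prod_eq_prod
    (f := fun k (x : ℝ) => Complex.exp ((m k + t k * Complex.I) * x))]
  have h2 : ∀ k, ∫ x : ℝ, Complex.exp ((m k + t k * Complex.I) * x) ∂(gaussianReal 0 1) =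
      Complex.exp ((m k + t k * Complex.I) ^ 2 / 2) := by
    intro k
    have := complexMGF_id_gaussianReal (μ := 0) (v := 1) (m k + t k * Complex.I)
    simpa [complexMGF] using this
  simp_rw [h2]
  rw [← Complex.exp_sum]
  congr 1
  rw [← Complex.ofReal_pow, ← Complex.ofReal_pow, EuclideanSpace.real_norm_sq_eq,
    EuclideanSpace.real_norm_sq_eq]
  simp only [PiLp.inner_apply, RCLike.inner_apply, conj_trivial, Complex.ofReal_sum,
      Complex.ofReal_mul, Complex.ofReal_pow, Finset.sum_mul, Finset.sum_div,
      ← Finset.sum_add_distrib, ← Finset.sum_sub_distrib]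
  refine Finset.sum_congr rfl fun k _ => ?_
  linear_combination (t k : ℂ) ^ 2 / 2 * Complex.I_sq

/-- The Cameron-Martin formula for the standard Gaussian measure. -/
theorem tilted_stdGaussian (m : EuclideanSpace ℝ ι) :
    (stdGaussian (EuclideanSpace ℝ ι)).tilted (fun x => ⟪m, x⟫) =
      (stdGaussian (EuclideanSpace ℝ ι)).map (fun x => m + x) := by
  have := isProbabilityMeasure_tilted (integrable_exp_inner_stdGaussian m)
  have : IsProbabilityMeasure ((stdGaussian (EuclideanSpace ℝ ι)).map (fun x => m + x)) :=
    Measure.isProbabilityMeasure_map (by fun_prop)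
  refine Measure.ext_of_charFun (funext fun t => ?_)
  rw [charFun_map_const_add, charFun_stdGaussian, charFun_apply, integral_tilted,
    integral_exp_inner_stdGaussian]
  have h : ∀ x : EuclideanSpace ℝ ι,
      (Real.exp ⟪m, x⟫ / Real.exp (‖m‖ ^ 2 / 2)) • Complex.exp (⟪x, t⟫ * Complex.I) =
      Complex.exp (-(‖m‖ ^ 2 / 2)) * Complex.exp (⟪m, x⟫ + ⟪x, t⟫ * Complex.I) := by
    intro x
    rw [Complex.real_smul, Complex.exp_add, Complex.exp_neg]
    push_cast
    ring
  simp_rw [h]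
  rw [integral_const_mul, integral_cexp_stdGaussian, ← Complex.exp_add, ← Complex.exp_add]
  congr 1
  ring

/-- Gaussian volumes of translates of a set depend analytically on the translation. -/
theorem analyticOnNhd_stdGaussian_translate {B : Set (EuclideanSpace ℝ ι)} (hB : MeasurableSet B)
    (m : EuclideanSpace ℝ ι) :
    AnalyticOnNhd ℝ (fun t : ℝ =>
      (stdGaussian (EuclideanSpace ℝ ι)).real {x | t • m + x ∈ B}) Set.univ := by
  set γ := stdGaussian (EuclideanSpace ℝ ι)
  -- Cameron-Martin moves the translation from the set into an exponential weight, leaving a moment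
  -- generating function, which is analytic wherever exponential moments exist: here on all of `ℝ`.
  have h : (fun t : ℝ => γ.real {x | t • m + x ∈ B}) = fun t =>
      Real.exp (-(t ^ 2 * ‖m‖ ^ 2 / 2)) * mgf (fun x => ⟪m, x⟫) (γ.restrict B) t := by
    funext t
    have h1 : γ {x | t • m + x ∈ B} = γ.tilted (fun x => ⟪t • m, x⟫) B := by
      rw [tilted_stdGaussian, Measure.map_apply (by fun_prop) hB]
      rfl
    rw [measureReal_def, h1, tilted_apply_eq_ofReal_integral, integral_exp_inner_stdGaussian,
      ENNReal.toReal_ofReal (integral_nonneg fun x => by positivity), integral_div, mgf,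
      Real.exp_neg, norm_smul, mul_pow, Real.norm_eq_abs, sq_abs]
    simp_rw [real_inner_smul_left]
    ring
  rw [h]
  intro t _
  refine AnalyticAt.mul (by fun_prop) (analyticAt_mgf ?_)
  have : integrableExpSet (fun x => ⟪m, x⟫) (γ.restrict B) = Set.univ := by
    refine Set.eq_univ_of_forall fun s => ?_
    have := (integrable_exp_inner_stdGaussian (s • m)).restrict (s := B)
    simpa [integrableExpSet, real_inner_smul_left] using this
  simp [this]

/-- If `x` and `z` are independent standard Gaussian vectors, then the pair
`(x, ρ x + √(1 - ρ²) z)` is exchangeable. -/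
theorem integral_exchange {ρ : ℝ} (h1 : -1 ≤ ρ) (h2 : ρ ≤ 1)
    {F : EuclideanSpace ℝ ι × EuclideanSpace ℝ ι → ℝ} (hF : Measurable F) :
    ∫ p, F (p.1, ρ • p.1 + Real.sqrt (1 - ρ ^ 2) • p.2)
        ∂((stdGaussian (EuclideanSpace ℝ ι)).prod (stdGaussian (EuclideanSpace ℝ ι))) =
      ∫ p, F (ρ • p.1 + Real.sqrt (1 - ρ ^ 2) • p.2, p.1)
        ∂((stdGaussian (EuclideanSpace ℝ ι)).prod (stdGaussian (EuclideanSpace ℝ ι))) := by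
  set γ := stdGaussian (EuclideanSpace ℝ ι)
  -- The swap is induced by an orthogonal reflection of the pair: rotation by `arccos ρ` composed
  -- with a sign change of the second coordinate, both preserving the product measure.
  have hneg : (γ.prod γ).map (Prod.map id (fun x => -x)) = γ.prod γ := by
    rw [← Measure.map_prod_map _ _ measurable_id measurable_neg, Measure.map_id]
    congr 1
    exact map_neg_stdGaussian
  have hrot : (γ.prod γ).map (ContinuousLinearMap.rotation (Real.arccos ρ)) = γ.prod γ :=
    IsGaussian.map_rotation_eq_self (by simp [γ]) _
  conv_rhs => rw [← hneg]
  rw [integral_map (by fun_prop) (by exact (hF.comp (by fun_prop)).aestronglyMeasurable)]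
  conv_rhs => rw [← hrot]
  rw [integral_map (by fun_prop) (by exact (hF.comp (by fun_prop)).aestronglyMeasurable)]
  have hs : Real.sqrt (1 - ρ ^ 2) ^ 2 = 1 - ρ ^ 2 := Real.sq_sqrt (by nlinarith)
  refine integral_congr_ae (Filter.Eventually.of_forall fun p => ?_)
  simp only [ContinuousLinearMap.rotation_apply, Prod.map_apply, id_eq, Real.cos_arccos h1 h2,
    Real.sin_arccos]
  congr 2
  have : p.1 = (ρ ^ 2 + Real.sqrt (1 - ρ ^ 2) ^ 2) • p.1 := by rw [hs]; simp
  conv_lhs => rw [this]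
  module

end Gaussian

/-! ### Limits of measures, sets of prescribed mass, small balls -/

section Measure

/-- Dominated convergence for indicators; continuity and limits of Gaussian volumes below reduce to
pointwise stability of membership. -/
theorem tendsto_measureReal_of_ae_eventually {α β : Type*} [MeasurableSpace α] {μ : Measure α}
    [IsFiniteMeasure μ] {l : Filter β} [l.IsCountablyGenerated] {S : β → Set α}
    {S₀ : Set α} (hS : ∀ b, MeasurableSet (S b)) (hS₀ : MeasurableSet S₀)
    (h : ∀ᵐ x ∂μ, ∀ᶠ b in l, x ∈ S b ↔ x ∈ S₀) :
    Filter.Tendsto (fun b => μ.real (S b)) l (𝓝 (μ.real S₀)) := by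
  exact (ENNReal.tendsto_toReal (measure_ne_top μ S₀)).comp
    (tendsto_measure_of_ae_tendsto_indicator_of_isFiniteMeasure l hS₀ hS h)

variable {ι : Type*} [Fintype ι] [Nonempty ι]

/-- Intermediate value property of the standard Gaussian measure. -/
theorem exists_subset_stdGaussian_eq {V : Set (EuclideanSpace ℝ ι)} (hV : MeasurableSet V) {c : ℝ}
    (h0 : 0 < c) (hc : c < (stdGaussian (EuclideanSpace ℝ ι)).real V) :
    ∃ E ⊆ V, MeasurableSet E ∧ (stdGaussian (EuclideanSpace ℝ ι)).real E = c := by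
  set γ := stdGaussian (EuclideanSpace ℝ ι)
  obtain ⟨d, hd⟩ := exists_ne (0 : EuclideanSpace ℝ ι)
  -- Sweep `V` by half-spaces; the mass grows continuously from 0 to that of `V` because hyperplanes
  -- are null.
  have hmeas : ∀ s : ℝ, MeasurableSet (V ∩ {x | ⟪d, x⟫ ≤ s}) := fun s =>
    hV.inter (measurableSet_le (by fun_prop) (by fun_prop))
  have hcont : Continuous fun s : ℝ => γ.real (V ∩ {x | ⟪d, x⟫ ≤ s}) := by
    refine continuous_iff_continuousAt.2 fun s => ?_
    refine tendsto_measureReal_of_ae_eventually hmeas (hmeas s) ?_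
    have : ∀ᵐ x ∂γ, ⟪d, x⟫ ≠ s := measure_eq_zero_iff_ae_notMem.1 (stdGaussian_hyperplane hd s)
    filter_upwards [this] with x hx
    rcases lt_or_gt_of_ne hx with hx | hx
    · filter_upwards [lt_mem_nhds hx] with b hb
      simp [hb.le, hx.le]
    · filter_upwards [gt_mem_nhds hx] with b hb
      simp [hb.not_ge, hx.not_ge]
  have htop : Filter.Tendsto (fun s : ℝ => γ.real (V ∩ {x | ⟪d, x⟫ ≤ s})) Filter.atTop
      (𝓝 (γ.real V)) := by
    refine tendsto_measureReal_of_ae_eventually hmeas hV (Filter.Eventually.of_forall fun x => ?_)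
    filter_upwards [Filter.eventually_ge_atTop ⟪d, x⟫] with s hs
    simp [hs]
  have hbot : Filter.Tendsto (fun s : ℝ => γ.real (V ∩ {x | ⟪d, x⟫ ≤ s})) Filter.atBot
      (𝓝 (γ.real ∅)) := by
    refine tendsto_measureReal_of_ae_eventually hmeas .empty
      (Filter.Eventually.of_forall fun x => ?_)
    filter_upwards [Filter.eventually_lt_atBot ⟪d, x⟫] with s hs
    simp [hs]
  rw [measureReal_empty] at hbot
  obtain ⟨s₁, hs₁⟩ := (hbot.eventually_lt_const h0).exists
  obtain ⟨s₂, hs₂⟩ := (htop.eventually_const_lt hc).exists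
  obtain ⟨s, hs⟩ := mem_range_of_exists_le_of_exists_ge hcont ⟨s₁, hs₁.le⟩ ⟨s₂, hs₂.le⟩
  exact ⟨_, Set.inter_subset_left, hmeas s, hs⟩

theorem exists_subsets_stdGaussian_eq {V W : Set (EuclideanSpace ℝ ι)} (hV : IsOpen V)
    (hW : IsOpen W) (hV' : V.Nonempty) (hW' : W.Nonempty) :
    ∃ E ⊆ V, ∃ F ⊆ W, MeasurableSet E ∧ MeasurableSet F ∧
      0 < (stdGaussian (EuclideanSpace ℝ ι)).real E ∧
      (stdGaussian (EuclideanSpace ℝ ι)).real E = (stdGaussian (EuclideanSpace ℝ ι)).real F := by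
  set γ := stdGaussian (EuclideanSpace ℝ ι)
  have h1 : 0 < γ.real V :=
    ENNReal.toReal_pos (hV.measure_pos γ hV').ne' (measure_ne_top γ V)
  have h2 : 0 < γ.real W :=
    ENNReal.toReal_pos (hW.measure_pos γ hW').ne' (measure_ne_top γ W)
  have h3 : 0 < min (γ.real V) (γ.real W) := lt_min h1 h2
  obtain ⟨E, hE, hEm, hE'⟩ := exists_subset_stdGaussian_eq hV.measurableSet (half_pos h3)
    ((half_lt_self h3).trans_le (min_le_left _ _))
  obtain ⟨F, hF, hFm, hF'⟩ := exists_subset_stdGaussian_eq hW.measurableSet (half_pos h3)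
    ((half_lt_self h3).trans_le (min_le_right _ _))
  exact ⟨E, hE, F, hF, hEm, hFm, hE' ▸ half_pos h3, hE'.trans hF'.symm⟩

theorem sqrt_one_sub_sq_pos {ρ : ℝ} (h1 : -1 < ρ) (h2 : ρ < 1) : 0 < Real.sqrt (1 - ρ ^ 2) :=
  Real.sqrt_pos.2 (by nlinarith)

/-- Small balls have uniformly small Gaussian transition probability. -/
theorem eventually_transition_ball_lt {ρ : ℝ} (h1 : -1 < ρ) (h2 : ρ < 1)
    (p q : EuclideanSpace ℝ ι) {δ : ℝ} (hδ : 0 < δ) :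
    ∀ᶠ r in 𝓝[>] (0 : ℝ), ∀ x ∈ Metric.ball p r,
      (stdGaussian (EuclideanSpace ℝ ι)).real
        {z | ρ • x + Real.sqrt (1 - ρ ^ 2) • z ∈ Metric.ball q r} < δ := by
  set γ := stdGaussian (EuclideanSpace ℝ ι)
  set σ := Real.sqrt (1 - ρ ^ 2)
  have hσ : σ ≠ 0 := (sqrt_one_sub_sq_pos h1 h2).ne'
  -- The doubled radius absorbs the shift `ρ • (x - p)`, of norm less than `r`, making the bound
  -- uniform over the ball.
  have hlim : Filter.Tendsto (fun r : ℝ => γ.real {z | ‖ρ • p + σ • z - q‖ < 2 * r}) (𝓝[>] 0)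
      (𝓝 (γ.real ∅)) := by
    refine tendsto_measureReal_of_ae_eventually
      (fun r => measurableSet_lt (by fun_prop) (by fun_prop)) .empty ?_
    have : ∀ᵐ z ∂γ, z ≠ σ⁻¹ • (q - ρ • p) :=
      measure_eq_zero_iff_ae_notMem.1 (stdGaussian_singleton _)
    filter_upwards [this] with z hz
    have hpos : 0 < ‖ρ • p + σ • z - q‖ := by
      refine norm_pos_iff.2 fun h => hz ?_
      have : σ • z = q - ρ • p := by
        rw [← sub_eq_zero.1 h]
        abel
      rw [← this, smul_smul, inv_mul_cancel₀ hσ, one_smul]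
    have : ∀ᶠ r in 𝓝[>] (0 : ℝ), r < ‖ρ • p + σ • z - q‖ / 2 :=
      nhdsWithin_le_nhds (gt_mem_nhds (half_pos hpos))
    filter_upwards [this] with r hr
    simp only [Set.mem_empty_iff_false, iff_false, not_lt]
    linarith
  rw [measureReal_empty] at hlim
  filter_upwards [hlim.eventually_lt_const hδ] with r hr x hx
  refine (measureReal_mono fun z hz => ?_).trans_lt hr
  simp only [Set.mem_ofPred_eq, mem_ball_iff_norm] at hz hx ⊢
  have h3 : ρ • p + σ • z - q = (ρ • x + σ • z - q) - ρ • (x - p) := by module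
  have h4 : ‖ρ • (x - p)‖ ≤ ‖x - p‖ := by
    rw [norm_smul]
    exact mul_le_of_le_one_left (norm_nonneg _) (abs_le.2 ⟨h1.le, h2.le⟩)
  rw [h3]
  have := norm_sub_le (ρ • x + σ • z - q) (ρ • (x - p))
  linarith

end Measure

/-! ### The symmetric bilinear form of noise stability -/

section Bilinear

variable {n : ℕ}

/-- Bounded measurable functions. -/
def BddMeasurable (u : EuclideanSpace ℝ (Fin n) → ℝ) : Prop :=
  Measurable u ∧ ∃ C, ∀ x, ‖u x‖ ≤ C

theorem BddMeasurable.add {u v : EuclideanSpace ℝ (Fin n) → ℝ} (hu : BddMeasurable u)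
    (hv : BddMeasurable v) : BddMeasurable (u + v) := by
  obtain ⟨hu, C, hC⟩ := hu
  obtain ⟨hv, D, hD⟩ := hv
  exact ⟨hu.add hv, C + D, fun x => norm_add_le_of_le (hC x) (hD x)⟩

theorem BddMeasurable.sub {u v : EuclideanSpace ℝ (Fin n) → ℝ} (hu : BddMeasurable u)
    (hv : BddMeasurable v) : BddMeasurable (u - v) := by
  obtain ⟨hu, C, hC⟩ := hu
  obtain ⟨hv, D, hD⟩ := hv
  exact ⟨hu.sub hv, C + D, fun x => norm_sub_le_of_le (hC x) (hD x)⟩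

theorem bddMeasurable_indicator {A : Set (EuclideanSpace ℝ (Fin n))} (hA : MeasurableSet A) :
    BddMeasurable (A.indicator fun _ => (1 : ℝ)) :=
  ⟨measurable_const.indicator hA, 1, fun x => by
    by_cases h : x ∈ A <;> simp [h]⟩

theorem BddMeasurable.integrable_comp {α : Type*} [MeasurableSpace α] {μ : Measure α}
    [IsFiniteMeasure μ] {u : EuclideanSpace ℝ (Fin n) → ℝ} (hu : BddMeasurable u)
    {g : α → EuclideanSpace ℝ (Fin n)} (hg : Measurable g) : Integrable (fun a => u (g a)) μ := by
  obtain ⟨hu, C, hC⟩ := hu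
  exact Integrable.of_bound (hu.comp hg).aestronglyMeasurable C
    (Filter.Eventually.of_forall fun a => hC _)

variable {ρ : ℝ} {u v w : EuclideanSpace ℝ (Fin n) → ℝ}

theorem ornsteinUhlenbeck_add (hu : BddMeasurable u) (hv : BddMeasurable v)
    (x : EuclideanSpace ℝ (Fin n)) : ornsteinUhlenbeck ρ (u + v) x =
      ornsteinUhlenbeck ρ u x + ornsteinUhlenbeck ρ v x :=
  integral_add (hu.integrable_comp (by fun_prop)) (hv.integrable_comp (by fun_prop))

theorem ornsteinUhlenbeck_sub (hu : BddMeasurable u) (hv : BddMeasurable v)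
    (x : EuclideanSpace ℝ (Fin n)) : ornsteinUhlenbeck ρ (u - v) x =
      ornsteinUhlenbeck ρ u x - ornsteinUhlenbeck ρ v x :=
  integral_sub (hu.integrable_comp (by fun_prop)) (hv.integrable_comp (by fun_prop))

theorem ornsteinUhlenbeck_indicator {A : Set (EuclideanSpace ℝ (Fin n))} (hA : MeasurableSet A)
    (x : EuclideanSpace ℝ (Fin n)) :
    ornsteinUhlenbeck ρ (A.indicator fun _ => (1 : ℝ)) x =
      (stdGaussian (EuclideanSpace ℝ (Fin n))).real {z | ρ • x + Real.sqrt (1 - ρ ^ 2) • z ∈ A} := by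
  have hm : Measurable fun z : EuclideanSpace ℝ (Fin n) => ρ • x + Real.sqrt (1 - ρ ^ 2) • z := by
    fun_prop
  exact integral_indicator_one (hm hA)

theorem BddMeasurable.ornsteinUhlenbeck (ρ : ℝ) (hu : BddMeasurable u) :
    BddMeasurable (ornsteinUhlenbeck ρ u) := by
  obtain ⟨hu, C, hC⟩ := hu
  refine ⟨?_, C, fun x => ?_⟩
  · have : Measurable fun p : EuclideanSpace ℝ (Fin n) × EuclideanSpace ℝ (Fin n) =>
        u (ρ • p.1 + Real.sqrt (1 - ρ ^ 2) • p.2) := hu.comp (by fun_prop)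
    exact (this.stronglyMeasurable.integral_prod_right').measurable
  · refine (norm_integral_le_of_norm_le_const (Filter.Eventually.of_forall fun z => hC _)).trans ?_
    simp

/-- The bilinear form `(u, v) ↦ ∫ u T_ρ v dγ_n`. -/
noncomputable def stabilityForm (ρ : ℝ) (u v : EuclideanSpace ℝ (Fin n) → ℝ) : ℝ :=
  ∫ x, u x * ornsteinUhlenbeck ρ v x ∂(stdGaussian (EuclideanSpace ℝ (Fin n)))

theorem BddMeasurable.mul (hu : BddMeasurable u) (hv : BddMeasurable v) :
    BddMeasurable (u * v) := by
  obtain ⟨hu, C, hC⟩ := hu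
  obtain ⟨hv, D, hD⟩ := hv
  refine ⟨hu.mul hv, C * D, fun x => ?_⟩
  rw [Pi.mul_apply, norm_mul]
  exact mul_le_mul (hC x) (hD x) (norm_nonneg _) ((norm_nonneg _).trans (hC x))

theorem BddMeasurable.integrable {μ : Measure (EuclideanSpace ℝ (Fin n))} [IsFiniteMeasure μ]
    (hu : BddMeasurable u) : Integrable u μ :=
  hu.integrable_comp measurable_id

theorem stabilityForm_add_left (hu : BddMeasurable u) (hv : BddMeasurable v)
    (hw : BddMeasurable w) :
    stabilityForm ρ (u + v) w = stabilityForm ρ u w + stabilityForm ρ v w := by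
  have h1 := (hu.mul (hw.ornsteinUhlenbeck ρ)).integrable
    (μ := stdGaussian (EuclideanSpace ℝ (Fin n)))
  have h2 := (hv.mul (hw.ornsteinUhlenbeck ρ)).integrable
    (μ := stdGaussian (EuclideanSpace ℝ (Fin n)))
  simp only [stabilityForm, Pi.add_apply, add_mul]
  exact integral_add h1 h2

/-- By Fubini the form is the expectation of `u(X) v(Y)` for an exchangeable pair. -/
theorem stabilityForm_comm (h1 : -1 ≤ ρ) (h2 : ρ ≤ 1) (hu : BddMeasurable u)
    (hv : BddMeasurable v) : stabilityForm ρ u v = stabilityForm ρ v u := by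
  have key : ∀ {u v : EuclideanSpace ℝ (Fin n) → ℝ}, BddMeasurable u → BddMeasurable v →
      stabilityForm ρ u v = ∫ p : EuclideanSpace ℝ (Fin n) × EuclideanSpace ℝ (Fin n),
        u p.1 * v (ρ • p.1 + Real.sqrt (1 - ρ ^ 2) • p.2)
        ∂((stdGaussian (EuclideanSpace ℝ (Fin n))).prod
          (stdGaussian (EuclideanSpace ℝ (Fin n)))) := by
    intro u v ⟨hu, C, hC⟩ ⟨hv, D, hD⟩
    rw [integral_prod]
    · simp_rw [integral_const_mul]
      rfl
    · refine Integrable.of_bound (C := C * D) (Measurable.aestronglyMeasurable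
        ((hu.comp (by fun_prop)).mul (hv.comp (by fun_prop))))
        (Filter.Eventually.of_forall fun p => ?_)
      rw [norm_mul]
      exact mul_le_mul (hC _) (hD _) (norm_nonneg _) ((norm_nonneg _).trans (hC 0))
  rw [key hu hv, key hv hu, integral_exchange h1 h2 (F := fun p => u p.1 * v p.2)
    ((hu.1.comp measurable_fst).mul (hv.1.comp measurable_snd))]
  simp_rw [mul_comm]

theorem stabilityForm_add_right (h1 : -1 ≤ ρ) (h2 : ρ ≤ 1) (hu : BddMeasurable u)
    (hv : BddMeasurable v) (hw : BddMeasurable w) :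
    stabilityForm ρ w (u + v) = stabilityForm ρ w u + stabilityForm ρ w v := by
  rw [stabilityForm_comm h1 h2 hw (hu.add hv), stabilityForm_add_left hu hv hw,
    stabilityForm_comm h1 h2 hu hw, stabilityForm_comm h1 h2 hv hw]

/-- The change of the quadratic form when mass is moved from one part to another. -/
theorem stabilityForm_exchange (h1 : -1 ≤ ρ) (h2 : ρ ≤ 1) (hu : BddMeasurable u)
    (hv : BddMeasurable v) (hw : BddMeasurable w) :
    stabilityForm ρ (u + w) (u + w) + stabilityForm ρ (v - w) (v - w) =
      stabilityForm ρ u u + stabilityForm ρ v v + 2 * stabilityForm ρ w (u - v + w) := by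
  have e1 := stabilityForm_add_left (ρ := ρ) hu hw (hu.add hw)
  have e2 := stabilityForm_add_right (ρ := ρ) h1 h2 hu hw hu
  have e3 := stabilityForm_add_right (ρ := ρ) h1 h2 hu hw hw
  have e4 := stabilityForm_comm (ρ := ρ) h1 h2 hu hw
  have hvw := hv.sub hw
  -- Expanding from `v - w` upwards means additivity alone suffices.
  have f0 : v = (v - w) + w := by simp
  have f1 := stabilityForm_add_left (ρ := ρ) hvw hw hv
  have f2 := stabilityForm_add_right (ρ := ρ) h1 h2 hvw hw hvw
  have f3 := stabilityForm_add_right (ρ := ρ) h1 h2 hvw hw hw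
  have f4 := stabilityForm_comm (ρ := ρ) h1 h2 hvw hw
  rw [← f0] at f1 f2 f3
  have huv := hu.sub hv
  have g0 : u = (u - v) + v := by simp
  have g1 := stabilityForm_add_right (ρ := ρ) h1 h2 huv hv hw
  rw [← g0] at g1
  have g2 := stabilityForm_add_right (ρ := ρ) h1 h2 huv hw hw
  linarith

end Bilinear

/-! ### Exchanging mass between two parts: the first variation -/

section FirstVariation

variable {n k : ℕ}

theorem noiseStability_eq_sum_stabilityForm (ρ : ℝ)
    (A : Fin k → Set (EuclideanSpace ℝ (Fin n))) : noiseStability ρ A =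
      ∑ p, stabilityForm ρ ((A p).indicator fun _ => (1 : ℝ)) ((A p).indicator fun _ => (1 : ℝ)) :=
  rfl

/-- The difference of the noise-smoothed indicators of two parts. -/
noncomputable def stabilityGap (ρ : ℝ) (A : Fin k → Set (EuclideanSpace ℝ (Fin n))) (i j : Fin k)
    (x : EuclideanSpace ℝ (Fin n)) : ℝ :=
  ornsteinUhlenbeck ρ ((A i).indicator fun _ => (1 : ℝ)) x -
    ornsteinUhlenbeck ρ ((A j).indicator fun _ => (1 : ℝ)) x

/-- Exchange the sets `E` and `F` between the parts `i` and `j`. -/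
def exchangeParts (A : Fin k → Set (EuclideanSpace ℝ (Fin n))) (i j : Fin k)
    (E F : Set (EuclideanSpace ℝ (Fin n))) (p : Fin k) : Set (EuclideanSpace ℝ (Fin n)) :=
  if p = i then (A i \ F) ∪ E else if p = j then (A j \ E) ∪ F else A p

variable {A : Fin k → Set (EuclideanSpace ℝ (Fin n))} {i j : Fin k}
  {E F : Set (EuclideanSpace ℝ (Fin n))}

theorem isPartition_exchangeParts (hA : IsPartition A) (hij : i ≠ j) (hEm : MeasurableSet E)
    (hFm : MeasurableSet F) (hE : E ⊆ A j \ A i) (hF : F ⊆ A i \ A j) :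
    IsPartition (exchangeParts A i j E F) := by
  refine ⟨fun p => ?_, ?_, ?_⟩
  · unfold exchangeParts
    split_ifs
    · exact ((hA.measurable i).diff hFm).union hEm
    · exact ((hA.measurable j).diff hEm).union hFm
    · exact hA.measurable p
  · refine Set.eq_univ_of_forall fun x => Set.mem_iUnion.2 ?_
    by_cases hxE : x ∈ E
    · exact ⟨i, by simp [exchangeParts, hxE]⟩
    by_cases hxF : x ∈ F
    · exact ⟨j, by simp [exchangeParts, hij.symm, hxF]⟩
    obtain ⟨p, hp⟩ := Set.mem_iUnion.1 (hA.cover ▸ Set.mem_univ x)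
    refine ⟨p, ?_⟩
    unfold exchangeParts
    split_ifs with h h
    · exact Or.inl ⟨h ▸ hp, hxF⟩
    · exact Or.inl ⟨h ▸ hp, hxE⟩
    · exact hp
  · intro p q hpq
    -- A point in two distinct new parts already lies in two distinct old ones.
    have hnull : stdGaussian (EuclideanSpace ℝ (Fin n))
        (⋃ r, ⋃ s, ⋃ (_ : r ≠ s), A r ∩ A s) = 0 := by
      simp only [measure_iUnion_null_iff]
      exact hA.overlap
    refine measure_mono_null ?_ hnull
    rintro x ⟨hp, hq⟩
    simp only [Set.mem_iUnion, Set.mem_inter_iff, exists_prop]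
    have h1 := @hE x
    have h2 := @hF x
    simp only [Set.mem_sdiff] at h1 h2
    have key : ∀ r, r ≠ i → x ∈ exchangeParts A i j E F r → x ∈ E → r ≠ j ∧ x ∈ A r := by
      intro r hr hx hxE
      by_cases hrj : r = j
      · simp_all [exchangeParts]
      · simp_all [exchangeParts]
    have key' : ∀ r, r ≠ j → x ∈ exchangeParts A i j E F r → x ∈ F → r ≠ i ∧ x ∈ A r := by
      intro r hr hx hxF
      by_cases hri : r = i
      · simp_all [exchangeParts]
      · simp_all [exchangeParts]
    have key'' : ∀ r, x ∈ exchangeParts A i j E F r → x ∉ E → x ∉ F → x ∈ A r := by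
      intro r hx hxE hxF
      unfold exchangeParts at hx
      split_ifs at hx with h h
      · simp_all
      · simp_all
      · exact hx
    by_cases hxE : x ∈ E
    · by_cases hpi : p = i
      · obtain ⟨hqj, hq⟩ := key q (fun h => hpq (hpi.trans h.symm)) hq hxE
        exact ⟨q, j, hqj, hq, (h1 hxE).1⟩
      · obtain ⟨hpj, hp⟩ := key p hpi hp hxE
        exact ⟨p, j, hpj, hp, (h1 hxE).1⟩
    by_cases hxF : x ∈ F
    · by_cases hpj : p = j
      · obtain ⟨hqi, hq⟩ := key' q (fun h => hpq (hpj.trans h.symm)) hq hxF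
        exact ⟨q, i, hqi, hq, (h2 hxF).1⟩
      · obtain ⟨hpi, hp⟩ := key' p hpj hp hxF
        exact ⟨p, i, hpi, hp, (h2 hxF).1⟩
    exact ⟨p, q, hpq, key'' p hp hxE hxF, key'' q hq hxE hxF⟩

theorem indicator_exchangeParts_left (hE : E ⊆ A j \ A i) (hF : F ⊆ A i \ A j) :
    (exchangeParts A i j E F i).indicator (fun _ => (1 : ℝ)) =
      (A i).indicator (fun _ => (1 : ℝ)) +
        (E.indicator (fun _ => (1 : ℝ)) - F.indicator fun _ => (1 : ℝ)) := by
  funext x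
  have h1 := @hE x
  have h2 := @hF x
  by_cases hxE : x ∈ E <;> by_cases hxF : x ∈ F <;> by_cases hxi : x ∈ A i <;>
    by_cases hxj : x ∈ A j <;> simp_all [exchangeParts]

theorem indicator_exchangeParts_right (hij : i ≠ j) (hE : E ⊆ A j \ A i) (hF : F ⊆ A i \ A j) :
    (exchangeParts A i j E F j).indicator (fun _ => (1 : ℝ)) =
      (A j).indicator (fun _ => (1 : ℝ)) -
        (E.indicator (fun _ => (1 : ℝ)) - F.indicator fun _ => (1 : ℝ)) := by
  funext x
  have h1 := @hE x
  have h2 := @hF x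
  have h3 := hij.symm
  by_cases hxE : x ∈ E <;> by_cases hxF : x ∈ F <;> by_cases hxi : x ∈ A i <;>
    by_cases hxj : x ∈ A j <;> simp_all [exchangeParts]

theorem exchangeParts_of_ne {p : Fin k} (hi : p ≠ i) (hj : p ≠ j) :
    exchangeParts A i j E F p = A p := by
  simp [exchangeParts, hi, hj]

theorem hasVolumes_exchangeParts {a : Fin k → ℝ} (hA : IsPartition A) (ha : HasVolumes A a)
    (hij : i ≠ j) (hEm : MeasurableSet E) (hFm : MeasurableSet F) (hE : E ⊆ A j \ A i)
    (hF : F ⊆ A i \ A j)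
    (hEF : (stdGaussian (EuclideanSpace ℝ (Fin n))).real E =
      (stdGaussian (EuclideanSpace ℝ (Fin n))).real F) :
    HasVolumes (exchangeParts A i j E F) a := by
  have hB := (isPartition_exchangeParts hA hij hEm hFm hE hF).measurable
  have bE := (bddMeasurable_indicator hEm).integrable
    (μ := stdGaussian (EuclideanSpace ℝ (Fin n)))
  have bF := (bddMeasurable_indicator hFm).integrable
    (μ := stdGaussian (EuclideanSpace ℝ (Fin n)))
  have hint : ∀ {S : Set (EuclideanSpace ℝ (Fin n))}, MeasurableSet S →
      ∫ x, S.indicator (fun _ => (1 : ℝ)) x ∂(stdGaussian (EuclideanSpace ℝ (Fin n))) =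
        (stdGaussian (EuclideanSpace ℝ (Fin n))).real S := fun hS => integral_indicator_one hS
  intro p
  rw [← ha p]
  by_cases hi : p = i
  · subst hi
    rw [← hint (hB p), indicator_exchangeParts_left hE hF,
      integral_add' (bddMeasurable_indicator (hA.measurable p)).integrable (bE.sub bF),
      integral_sub' bE bF, hint hEm, hint hFm, hint (hA.measurable p), hEF]
    simp
  by_cases hj : p = j
  · subst hj
    rw [← hint (hB p), indicator_exchangeParts_right hij hE hF,
      integral_sub' (bddMeasurable_indicator (hA.measurable p)).integrable (bE.sub bF),
      integral_sub' bE bF, hint hEm, hint hFm, hint (hA.measurable p), hEF]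
    simp
  · rw [exchangeParts_of_ne hi hj]

theorem noiseStability_exchangeParts {ρ : ℝ} (h1 : -1 ≤ ρ) (h2 : ρ ≤ 1) (hA : IsPartition A)
    (hij : i ≠ j) (hEm : MeasurableSet E) (hFm : MeasurableSet F) (hE : E ⊆ A j \ A i)
    (hF : F ⊆ A i \ A j) :
    noiseStability ρ (exchangeParts A i j E F) = noiseStability ρ A +
      2 * stabilityForm ρ (E.indicator (fun _ => (1 : ℝ)) - F.indicator fun _ => (1 : ℝ))
        ((A i).indicator (fun _ => (1 : ℝ)) - (A j).indicator (fun _ => (1 : ℝ)) +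
          (E.indicator (fun _ => (1 : ℝ)) - F.indicator fun _ => (1 : ℝ))) := by
  have h := stabilityForm_exchange (ρ := ρ) h1 h2 (bddMeasurable_indicator (hA.measurable i))
    (bddMeasurable_indicator (hA.measurable j))
    ((bddMeasurable_indicator hEm).sub (bddMeasurable_indicator hFm))
  rw [← indicator_exchangeParts_left hE hF, ← indicator_exchangeParts_right hij hE hF] at h
  rw [noiseStability_eq_sum_stabilityForm, noiseStability_eq_sum_stabilityForm,
    ← sub_eq_iff_eq_add', ← Finset.sum_sub_distrib, Finset.sum_eq_add i j hij]
  · linarith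
  · rintro p - ⟨hi, hj⟩
    rw [exchangeParts_of_ne hi hj, sub_self]
  · simp
  · simp

/-- First variation of the noise stability: moving mass from part `j` near `x` to part `i`, and
the same mass from part `i` near `y` to part `j`, changes the noise stability at the rate
`2 (T_ρ(1_{A i} - 1_{A j})(x) - T_ρ(1_{A i} - 1_{A j})(y))`. -/
theorem exists_variation [Nonempty (Fin n)] {ρ : ℝ} (h1 : -1 < ρ) (h2 : ρ < 1) {a : Fin k → ℝ}
    (hA : IsPartition A) (ha : HasVolumes A a) (hij : i ≠ j)
    {U V : Set (EuclideanSpace ℝ (Fin n))} (hU : IsOpen U) (hV : IsOpen V) (hUA : U ⊆ A j \ A i)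
    (hVA : V ⊆ A i \ A j) {x y : EuclideanSpace ℝ (Fin n)} (hx : x ∈ closure U)
    (hy : y ∈ closure V) (hxc : ContinuousAt (stabilityGap ρ A i j) x)
    (hyc : ContinuousAt (stabilityGap ρ A i j) y) {δ : ℝ} (hδ : 0 < δ) :
    ∃ B : Fin k → Set (EuclideanSpace ℝ (Fin n)), IsPartition B ∧ HasVolumes B a ∧
      ∃ g > 0, |noiseStability ρ B - noiseStability ρ A -
        2 * g * (stabilityGap ρ A i j x - stabilityGap ρ A i j y)| ≤ 8 * δ * g := by
  set γ := stdGaussian (EuclideanSpace ℝ (Fin n))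
  have hcx : ∀ᶠ r in 𝓝[>] (0 : ℝ), ∀ z ∈ Metric.ball x r,
      |stabilityGap ρ A i j z - stabilityGap ρ A i j x| < δ := by
    obtain ⟨ε, hε, h⟩ := Metric.continuousAt_iff.1 hxc δ hδ
    filter_upwards [nhdsWithin_le_nhds (gt_mem_nhds hε)] with r hr z hz
    exact h ((Metric.mem_ball.1 hz).trans hr)
  have hcy : ∀ᶠ r in 𝓝[>] (0 : ℝ), ∀ z ∈ Metric.ball y r,
      |stabilityGap ρ A i j z - stabilityGap ρ A i j y| < δ := by
    obtain ⟨ε, hε, h⟩ := Metric.continuousAt_iff.1 hyc δ hδ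
    filter_upwards [nhdsWithin_le_nhds (gt_mem_nhds hε)] with r hr z hz
    exact h ((Metric.mem_ball.1 hz).trans hr)
  -- One radius for which the gap varies by less than `δ` on each ball and the quadratic
  -- self-interaction of the exchanged mass is also below `δ`.
  obtain ⟨r, ⟨⟨⟨⟨⟨⟨hcx, hcy⟩, hxx⟩, hxy⟩, hyx⟩, hyy⟩, hr⟩⟩ :=
    ((((((hcx.and hcy).and (eventually_transition_ball_lt h1 h2 x x hδ)).and
      (eventually_transition_ball_lt h1 h2 x y hδ)).and
      (eventually_transition_ball_lt h1 h2 y x hδ)).and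
      (eventually_transition_ball_lt h1 h2 y y hδ)).and self_mem_nhdsWithin).exists
  replace hr : 0 < r := hr
  obtain ⟨E, hE, F, hF, hEm, hFm, hE0, hEF⟩ := exists_subsets_stdGaussian_eq
    (hU.inter (Metric.isOpen_ball (x := x) (ε := r)))
    (hV.inter (Metric.isOpen_ball (x := y) (ε := r)))
    (by
      obtain ⟨z, hz, hz'⟩ := Metric.mem_closure_iff.1 hx r hr
      exact ⟨z, hz, by rwa [Metric.mem_ball, dist_comm]⟩)
    (by
      obtain ⟨z, hz, hz'⟩ := Metric.mem_closure_iff.1 hy r hr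
      exact ⟨z, hz, by rwa [Metric.mem_ball, dist_comm]⟩)
  have hEA : E ⊆ A j \ A i := (hE.trans Set.inter_subset_left).trans hUA
  have hFA : F ⊆ A i \ A j := (hF.trans Set.inter_subset_left).trans hVA
  have hEx : E ⊆ Metric.ball x r := hE.trans Set.inter_subset_right
  have hFy : F ⊆ Metric.ball y r := hF.trans Set.inter_subset_right
  refine ⟨exchangeParts A i j E F, isPartition_exchangeParts hA hij hEm hFm hEA hFA,
    hasVolumes_exchangeParts hA ha hij hEm hFm hEA hFA hEF, γ.real E, hE0, ?_⟩
  rw [noiseStability_exchangeParts h1.le h2.le hA hij hEm hFm hEA hFA, add_sub_cancel_left]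
  have bE := bddMeasurable_indicator hEm
  have bF := bddMeasurable_indicator hFm
  have bi := bddMeasurable_indicator (hA.measurable i)
  have bj := bddMeasurable_indicator (hA.measurable j)
  set G := ornsteinUhlenbeck ρ ((A i).indicator (fun _ => (1 : ℝ)) -
    (A j).indicator (fun _ => (1 : ℝ)) + (E.indicator (fun _ => (1 : ℝ)) -
      F.indicator fun _ => (1 : ℝ))) with hG
  have bG : BddMeasurable G := ((bi.sub bj).add (bE.sub bF)).ornsteinUhlenbeck ρ
  have hGeq : ∀ z, G z = stabilityGap ρ A i j z +
      (γ.real {w | ρ • z + Real.sqrt (1 - ρ ^ 2) • w ∈ E} -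
        γ.real {w | ρ • z + Real.sqrt (1 - ρ ^ 2) • w ∈ F}) := by
    intro z
    rw [hG, ornsteinUhlenbeck_add (bi.sub bj) (bE.sub bF), ornsteinUhlenbeck_sub bi bj,
      ornsteinUhlenbeck_sub bE bF, ornsteinUhlenbeck_indicator hEm, ornsteinUhlenbeck_indicator hFm]
    rfl
  have hmono : ∀ {S T : Set (EuclideanSpace ℝ (Fin n))} (z : EuclideanSpace ℝ (Fin n)), S ⊆ T →
      γ.real {w | ρ • z + Real.sqrt (1 - ρ ^ 2) • w ∈ S} ≤
        γ.real {w | ρ • z + Real.sqrt (1 - ρ ^ 2) • w ∈ T} :=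
    fun z h => measureReal_mono fun w hw => h hw
  -- The error `2 * δ` is `δ` from continuity plus `δ` from self-interaction. Summed over `E` and
  -- `F` and doubled by the quadratic form, it yields the final `8 * δ`.
  have bound : ∀ (S : Set (EuclideanSpace ℝ (Fin n))) (c : ℝ), MeasurableSet S →
      (∀ z ∈ S, |G z - c| ≤ 2 * δ) → |∫ z in S, G z ∂γ - γ.real S * c| ≤ 2 * δ * γ.real S := by
    intro S c hS h
    have h3 := norm_setIntegral_le_of_norm_le_const (μ := γ) (f := fun z => G z - c)
      (measure_lt_top γ S) h
    rwa [integral_sub bG.integrable (integrable_const c), setIntegral_const, smul_eq_mul,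
      Real.norm_eq_abs] at h3
  have hbE := bound E (stabilityGap ρ A i j x) hEm fun z hz => by
    have e1 := hcx z (hEx hz)
    have e2 := (hmono z hEx).trans_lt (hxx z (hEx hz))
    have e3 := (hmono z hFy).trans_lt (hxy z (hEx hz))
    rw [hGeq]
    rw [abs_lt] at e1
    have := measureReal_nonneg (μ := γ) (s := {w | ρ • z + Real.sqrt (1 - ρ ^ 2) • w ∈ E})
    have := measureReal_nonneg (μ := γ) (s := {w | ρ • z + Real.sqrt (1 - ρ ^ 2) • w ∈ F})
    rw [abs_le]
    constructor <;> linarith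
  have hbF := bound F (stabilityGap ρ A i j y) hFm fun z hz => by
    have e1 := hcy z (hFy hz)
    have e2 := (hmono z hEx).trans_lt (hyx z (hFy hz))
    have e3 := (hmono z hFy).trans_lt (hyy z (hFy hz))
    rw [hGeq]
    rw [abs_lt] at e1
    have := measureReal_nonneg (μ := γ) (s := {w | ρ • z + Real.sqrt (1 - ρ ^ 2) • w ∈ E})
    have := measureReal_nonneg (μ := γ) (s := {w | ρ • z + Real.sqrt (1 - ρ ^ 2) • w ∈ F})
    rw [abs_le]
    constructor <;> linarith
  have hform : stabilityForm ρ (E.indicator (fun _ => (1 : ℝ)) - F.indicator fun _ => (1 : ℝ))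
      ((A i).indicator (fun _ => (1 : ℝ)) - (A j).indicator (fun _ => (1 : ℝ)) +
        (E.indicator (fun _ => (1 : ℝ)) - F.indicator fun _ => (1 : ℝ))) =
      ∫ z in E, G z ∂γ - ∫ z in F, G z ∂γ := by
    rw [← integral_indicator hEm, ← integral_indicator hFm,
      ← integral_sub (bG.integrable.indicator hEm) (bG.integrable.indicator hFm)]
    refine integral_congr_ae (Filter.Eventually.of_forall fun z => ?_)
    by_cases hzE : z ∈ E <;> by_cases hzF : z ∈ F <;> simp [hzE, hzF, hG]
  rw [hform]
  rw [← hEF] at hbF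
  rw [abs_le] at hbE hbF ⊢
  constructor <;> linarith

end FirstVariation

/-! ### Adjacency of maximality cells -/

section Cells

variable {n k : ℕ}

/-- The open cone where the linear functional given by `v i` is strictly the largest. -/
def strictCell (v : Fin k → EuclideanSpace ℝ (Fin n)) (i : Fin k) :
    Set (EuclideanSpace ℝ (Fin n)) :=
  {x | ∀ j, j ≠ i → ⟪x, v j⟫ < ⟪x, v i⟫}

theorem isOpen_strictCell (v : Fin k → EuclideanSpace ℝ (Fin n)) (i : Fin k) :
    IsOpen (strictCell v i) := by
  have : strictCell v i = ⋂ j, ⋂ (_ : j ≠ i), {x | ⟪x, v j⟫ < ⟪x, v i⟫} := by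
    ext x; simp [strictCell]
  rw [this]
  exact isOpen_iInter_of_finite fun j => isOpen_iInter_of_finite fun _ =>
    isOpen_lt (by fun_prop) (by fun_prop)

/-- A nonempty open set contains a point avoiding finitely many hyperplanes. -/
theorem exists_mem_forall_inner_ne_zero {ι : Type*} [Countable ι]
    {U : Set (EuclideanSpace ℝ (Fin n))} (hU : IsOpen U) (hU' : U.Nonempty)
    (d : ι → EuclideanSpace ℝ (Fin n)) (hd : ∀ s, d s ≠ 0) : ∃ x ∈ U, ∀ s, ⟪d s, x⟫ ≠ 0 := by
  by_contra! h
  refine (hU.measure_pos (stdGaussian (EuclideanSpace ℝ (Fin n))) hU').ne' ?_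
  refine measure_mono_null (t := ⋃ s, {x | ⟪d s, x⟫ = 0}) (fun x hx => ?_)
    (measure_iUnion_null fun s => stdGaussian_hyperplane (hd s) 0)
  exact Set.mem_iUnion.2 (h x hx)

/-- If every functional is strictly the largest one somewhere, then no three of them lie on a
line. -/
theorem smul_sub_smul_ne_zero {v : Fin k → EuclideanSpace ℝ (Fin n)}
    (hv : ∀ i, (strictCell v i).Nonempty) {a b c : Fin k} (hab : a ≠ b) (hac : a ≠ c)
    (hbc : b ≠ c) {α β : ℝ} (hα : α ≠ 0) (hβ : β ≠ 0) :
    α • (v a - v c) - β • (v a - v b) ≠ 0 := by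
  intro h
  obtain ⟨xa, ha⟩ := hv a
  obtain ⟨xb, hb⟩ := hv b
  obtain ⟨xc, hc⟩ := hv c
  have key : ∀ x, α * (⟪x, v a⟫ - ⟪x, v c⟫) = β * (⟪x, v a⟫ - ⟪x, v b⟫) := by
    intro x
    have := congrArg (fun y => ⟪x, y⟫) h
    simp only [inner_sub_right, real_inner_smul_right, inner_zero_right] at this
    linarith
  have ka := key xa
  have kb := key xb
  have kc := key xc
  have a1 := ha b hab.symm
  have a2 := ha c hac.symm
  have b1 := hb a hab
  have b2 := hb c hbc.symm
  have c1 := hc a hac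
  have c2 := hc b hbc
  -- The relation at `xa` forces `α` and `β` to have the same sign; at `xb` it forces `|α| > |β|`,
  -- at `xc` the reverse.
  rcases lt_or_gt_of_ne hα with hα | hα <;> rcases lt_or_gt_of_ne hβ with hβ | hβ
  · rcases le_total α β with h | h
    · nlinarith
    · nlinarith
  · nlinarith
  · nlinarith
  · rcases le_total α β with h | h
    · nlinarith
    · nlinarith

/-- A function of the cells which agrees on adjacent cells is constant. -/
theorem eq_of_adjacent_eq {v : Fin k → EuclideanSpace ℝ (Fin n)}
    (hv : ∀ i, (strictCell v i).Nonempty) {α : Type*} (f : Fin k → α)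
    (hf : ∀ i j z, i ≠ j → ⟪z, v i⟫ = ⟪z, v j⟫ →
      (∀ l, l ≠ i → l ≠ j → ⟪z, v l⟫ < ⟪z, v i⟫) → f i = f j) (p q : Fin k) : f p = f q := by
  have hne : ∀ a b, a ≠ b → v a - v b ≠ 0 := by
    intro a b hab h
    obtain ⟨x, hx⟩ := hv a
    have := hx b hab.symm
    rw [sub_eq_zero.1 h] at this
    exact this.false
  obtain ⟨x, hx, hx'⟩ := exists_mem_forall_inner_ne_zero (isOpen_strictCell v q) (hv q)
    (fun s : {s : Fin k × Fin k // s.1 ≠ s.2} => v s.1.1 - v s.1.2) (fun s => hne _ _ s.2)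
  have hx'' : ∀ a b, a ≠ b → ⟪x, v a - v b⟫ ≠ 0 := fun a b hab => by
    rw [real_inner_comm]; exact hx' ⟨(a, b), hab⟩
  -- Eliminating the line parameter from a triple tie of `a`, `b`, `c` on the line through `x` and
  -- `w` makes `w` orthogonal to this vector, so a generic `w` excludes triple ties.
  obtain ⟨w, hw, hw'⟩ := exists_mem_forall_inner_ne_zero (isOpen_strictCell v p) (hv p)
    (fun s : {s : Fin k × Fin k × Fin k // s.1 ≠ s.2.1 ∧ s.1 ≠ s.2.2 ∧ s.2.1 ≠ s.2.2} =>
      ⟪x, v s.1.1 - v s.1.2.1⟫ • (v s.1.1 - v s.1.2.2) -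
        ⟪x, v s.1.1 - v s.1.2.2⟫ • (v s.1.1 - v s.1.2.1))
    (fun s => smul_sub_smul_ne_zero hv s.2.1 s.2.2.1 s.2.2.2 (hx'' _ _ s.2.1) (hx'' _ _ s.2.2.1))
  set l : ℝ → Fin k → ℝ := fun t a => ⟪x + t • (w - x), v a⟫ with hl
  have hlin : ∀ t a b, l t a - l t b = (1 - t) * ⟪x, v a - v b⟫ + t * ⟪w, v a - v b⟫ := by
    intro t a b
    simp only [hl, inner_add_left, inner_sub_left, inner_sub_right, real_inner_smul_left]
    ring
  have htriple : ∀ t a b c, a ≠ b → a ≠ c → b ≠ c → l t a = l t b → l t a ≠ l t c := by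
    intro t a b c hab hac hbc h1 h2
    have e1 := hlin t a b
    have e2 := hlin t a c
    rw [h1, sub_self] at e1
    rw [h2, sub_self] at e2
    have e3 := hw' ⟨(a, b, c), hab, hac, hbc⟩
    simp only [inner_sub_left, real_inner_smul_left] at e3
    rw [← inner_sub_left, ← inner_sub_left, real_inner_comm w, real_inner_comm w] at e3
    apply e3
    have ht : t ≠ 0 := by
      rintro rfl
      exact hx'' a b hab (by linarith)
    refine mul_left_cancel₀ ht ?_
    linear_combination ⟪x, v a - v c⟫ * e1 - ⟪x, v a - v b⟫ * e2
  have hcl : ∀ P : Fin k → Prop, IsClosed {t : ℝ | ∃ a, P a ∧ ∀ b, l t b ≤ l t a} := by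
    intro P
    have : {t : ℝ | ∃ a, P a ∧ ∀ b, l t b ≤ l t a} =
        ⋃ a, ⋃ (_ : P a), ⋂ b, {t | l t b ≤ l t a} := by
      ext t; simp
    rw [this]
    exact isClosed_iUnion_of_finite fun a => isClosed_iUnion_of_finite fun _ =>
      isClosed_iInter fun b => isClosed_le (by fun_prop) (by fun_prop)
  -- The parameters whose maximiser has value `f q`, and those with another value, form two nonempty
  -- closed sets covering `ℝ`. By connectedness they meet, at a tie of exactly two functionals.
  by_contra hpq
  have hcover : Set.univ ⊆ {t : ℝ | ∃ a, f a = f q ∧ ∀ b, l t b ≤ l t a} ∪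
      {t : ℝ | ∃ a, f a ≠ f q ∧ ∀ b, l t b ≤ l t a} := by
    intro t _
    have : Nonempty (Fin k) := ⟨q⟩
    obtain ⟨a, ha⟩ := Finite.exists_max (l t)
    by_cases h : f a = f q
    · exact Or.inl ⟨a, h, ha⟩
    · exact Or.inr ⟨a, h, ha⟩
  have hle : ∀ {z : EuclideanSpace ℝ (Fin n)} {a}, z ∈ strictCell v a →
      ∀ b, ⟪z, v b⟫ ≤ ⟪z, v a⟫ := by
    intro z a hz b
    rcases eq_or_ne b a with rfl | h
    · exact le_rfl
    · exact (hz b h).le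
  obtain ⟨t, -, ⟨a, ha, ha'⟩, ⟨b, hb, hb'⟩⟩ := isPreconnected_closed_iff.1 isPreconnected_univ _ _
    (hcl _) (hcl _) hcover ⟨0, trivial, q, rfl, by simpa [hl] using hle hx⟩
    ⟨1, trivial, p, hpq, by simpa [hl] using hle hw⟩
  have hab : a ≠ b := fun h => hb (h ▸ ha)
  have heq : l t a = l t b := le_antisymm (hb' a) (ha' b)
  exact hb ((hf a b _ hab heq fun c hca hcb =>
    lt_of_le_of_ne (ha' c) (htriple t a b c hab hca.symm hcb.symm heq).symm).symm.trans ha)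

end Cells

/-! ### Flat partitions: regularity and asymptotics along an interface -/

section Flat

variable {n k : ℕ}

theorem ae_inner_add_smul_ne {d : EuclideanSpace ℝ (Fin n)} (hd : d ≠ 0) {σ : ℝ} (hσ : σ ≠ 0)
    (b : EuclideanSpace ℝ (Fin n)) :
    ∀ᵐ z ∂(stdGaussian (EuclideanSpace ℝ (Fin n))), ⟪b + σ • z, d⟫ ≠ 0 := by
  refine measure_eq_zero_iff_ae_notMem.1
    (measure_mono_null (fun z hz => ?_) (stdGaussian_hyperplane hd (-⟪b, d⟫ / σ)))
  have hz : ⟪b + σ • z, d⟫ = 0 := hz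
  rw [inner_add_left, real_inner_smul_left] at hz
  change ⟪d, z⟫ = -⟪b, d⟫ / σ
  rw [real_inner_comm, eq_div_iff hσ]
  linarith

/-- The half-spaces differ by at least an open strip around the origin, which has positive mass. -/
theorem stdGaussian_halfspace_lt (d : EuclideanSpace ℝ (Fin n)) (σ : ℝ) {β : ℝ} (hβ : 0 < β) :
    (stdGaussian (EuclideanSpace ℝ (Fin n))).real {z | β ≤ σ * ⟪z, d⟫} <
      (stdGaussian (EuclideanSpace ℝ (Fin n))).real {z | -β ≤ σ * ⟪z, d⟫} := by
  set γ := stdGaussian (EuclideanSpace ℝ (Fin n))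
  have hO : IsOpen {z : EuclideanSpace ℝ (Fin n) | |σ * ⟪z, d⟫| < β} :=
    isOpen_lt (by fun_prop) (by fun_prop)
  have hpos : 0 < γ.real {z : EuclideanSpace ℝ (Fin n) | |σ * ⟪z, d⟫| < β} :=
    ENNReal.toReal_pos (hO.measure_pos γ ⟨0, by simpa using hβ⟩).ne' (measure_ne_top γ _)
  have hdisj : Disjoint {z : EuclideanSpace ℝ (Fin n) | β ≤ σ * ⟪z, d⟫}
      {z : EuclideanSpace ℝ (Fin n) | |σ * ⟪z, d⟫| < β} := by
    refine Set.disjoint_left.2 fun z hz hz' => ?_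
    have hz : β ≤ σ * ⟪z, d⟫ := hz
    exact absurd ((le_abs_self _).trans_lt hz') hz.not_gt
  have h := measureReal_union (μ := γ) hdisj hO.measurableSet
  have h' : γ.real ({z : EuclideanSpace ℝ (Fin n) | β ≤ σ * ⟪z, d⟫} ∪
      {z : EuclideanSpace ℝ (Fin n) | |σ * ⟪z, d⟫| < β}) ≤ γ.real {z | -β ≤ σ * ⟪z, d⟫} := by
    refine measureReal_mono ?_
    rintro z (hz | hz)
    · have hz : β ≤ σ * ⟪z, d⟫ := hz
      change -β ≤ σ * ⟪z, d⟫
      linarith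
    · have hz : |σ * ⟪z, d⟫| < β := hz
      exact (abs_lt.1 hz).1.le
  linarith

theorem stdGaussian_real_preimage_neg {S : Set (EuclideanSpace ℝ (Fin n))}
    (hS : MeasurableSet S) : (stdGaussian (EuclideanSpace ℝ (Fin n))).real {z | -z ∈ S} =
      (stdGaussian (EuclideanSpace ℝ (Fin n))).real S := by
  conv_rhs => rw [← map_neg_stdGaussian]
  rw [map_measureReal_apply measurable_neg hS]
  rfl

/-- A hyperplane whose two sides have the same mass passes through the mean. -/
theorem inner_eq_of_stdGaussian_halfspace_eq {b d e : EuclideanSpace ℝ (Fin n)} {σ : ℝ}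
    (h : (stdGaussian (EuclideanSpace ℝ (Fin n))).real {z | ⟪b + σ • z, e⟫ ≤ ⟪b + σ • z, d⟫} =
      (stdGaussian (EuclideanSpace ℝ (Fin n))).real {z | ⟪b + σ • z, d⟫ ≤ ⟪b + σ • z, e⟫}) :
    ⟪b, d⟫ = ⟪b, e⟫ := by
  rw [← stdGaussian_real_preimage_neg (S := {z | ⟪b + σ • z, d⟫ ≤ ⟪b + σ • z, e⟫})
    (measurableSet_le (by fun_prop) (by fun_prop))] at h
  -- After reflecting one side through the origin, the two half-spaces are parallel and nested, with
  -- opposite offsets.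
  have e1 : {z : EuclideanSpace ℝ (Fin n) | ⟪b + σ • z, e⟫ ≤ ⟪b + σ • z, d⟫} =
      {z | -(⟪b, d⟫ - ⟪b, e⟫) ≤ σ * ⟪z, d - e⟫} := by
    ext z
    simp only [Set.mem_ofPred_eq, inner_add_left, real_inner_smul_left, inner_sub_right]
    constructor <;> intro <;> linarith
  have e2 : {z : EuclideanSpace ℝ (Fin n) | -z ∈ {z | ⟪b + σ • z, d⟫ ≤ ⟪b + σ • z, e⟫}} =
      {z | ⟪b, d⟫ - ⟪b, e⟫ ≤ σ * ⟪z, d - e⟫} := by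
    ext z
    simp only [Set.mem_ofPred_eq, inner_add_left, real_inner_smul_left, inner_sub_right,
      inner_neg_left]
    constructor <;> intro <;> linarith
  rw [e1, e2] at h
  rcases lt_trichotomy ⟪b, d⟫ ⟪b, e⟫ with hlt | heq | hgt
  · have := stdGaussian_halfspace_lt (d - e) σ (neg_pos.2 (sub_neg.2 hlt))
    rw [neg_neg, h] at this
    exact absurd this (lt_irrefl _)
  · exact heq
  · have := stdGaussian_halfspace_lt (d - e) σ (sub_pos.2 hgt)
    rw [h] at this
    exact absurd this (lt_irrefl _)

/-- The parts `A i` are the maximality regions, with apex `y`, of the functionals `v i`. -/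
def IsMaxPartition (A : Fin k → Set (EuclideanSpace ℝ (Fin n))) (y : EuclideanSpace ℝ (Fin n))
    (v : Fin k → EuclideanSpace ℝ (Fin n)) : Prop :=
  ∀ i x, x ∈ A i ↔ ∀ j, ⟪x - y, v j⟫ ≤ ⟪x - y, v i⟫

variable {A : Fin k → Set (EuclideanSpace ℝ (Fin n))} {y : EuclideanSpace ℝ (Fin n)}
  {v : Fin k → EuclideanSpace ℝ (Fin n)}

/-- Ties fill only finitely many hyperplanes, which cannot carry a part of positive volume. -/
theorem IsMaxPartition.strictCell_nonempty (h : IsMaxPartition A y v)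
    (hv : Function.Injective v) {i : Fin k}
    (hpos : 0 < (stdGaussian (EuclideanSpace ℝ (Fin n))).real (A i)) :
    (strictCell v i).Nonempty := by
  have hae : ∀ᵐ x ∂(stdGaussian (EuclideanSpace ℝ (Fin n))), ∀ j, j ≠ i →
      ⟪-y + (1 : ℝ) • x, v j - v i⟫ ≠ 0 := by
    refine ae_all_iff.2 fun j => ?_
    by_cases hj : j = i
    · simp [hj]
    · filter_upwards [ae_inner_add_smul_ne (sub_ne_zero.2 (hv.ne hj)) one_ne_zero (-y)] with x hx _
      exact hx
  have hfreq : ∃ᶠ x in ae (stdGaussian (EuclideanSpace ℝ (Fin n))), x ∈ A i := by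
    rw [frequently_ae_mem_iff]
    intro h0
    rw [measureReal_def, h0] at hpos
    simp at hpos
  obtain ⟨x, hx, hx'⟩ := (hfreq.and_eventually hae).exists
  refine ⟨x - y, fun j hj => lt_of_le_of_ne ((h i x).1 hx j) fun heq => hx' j hj ?_⟩
  rw [one_smul, neg_add_eq_sub, inner_sub_right, heq, sub_self]

theorem isOpen_translate_strictCell (y : EuclideanSpace ℝ (Fin n))
    (v : Fin k → EuclideanSpace ℝ (Fin n)) (i : Fin k) :
    IsOpen {x | x - y ∈ strictCell v i} :=
  (isOpen_strictCell v i).preimage (by fun_prop)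

theorem IsMaxPartition.translate_strictCell_subset (h : IsMaxPartition A y v) {i j : Fin k}
    (hij : i ≠ j) : {x | x - y ∈ strictCell v i} ⊆ A i \ A j := by
  intro x hx
  refine ⟨(h i x).2 fun l => ?_, fun hj => ?_⟩
  · rcases eq_or_ne l i with rfl | hl
    · exact le_rfl
    · exact (hx l hl).le
  · exact ((h j x).1 hj i).not_gt (hx j hij.symm)

/-- Adding a small multiple of a direction in the strict cell makes every weak inequality strict. -/
theorem IsMaxPartition.subset_closure (h : IsMaxPartition A y v) {i : Fin k}
    (hi : (strictCell v i).Nonempty) : A i ⊆ closure {x | x - y ∈ strictCell v i} := by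
  intro x hx
  obtain ⟨w, hw⟩ := hi
  have hlim : Filter.Tendsto (fun t : ℝ => x + t • w) (𝓝[>] 0) (𝓝 x) := by
    have : Continuous fun t : ℝ => x + t • w := by fun_prop
    simpa using (this.tendsto 0).mono_left nhdsWithin_le_nhds
  refine mem_closure_of_tendsto hlim ?_
  filter_upwards [self_mem_nhdsWithin] with t ht j hj
  have ht : 0 < t := ht
  have h1 := (h i x).1 hx j
  have h2 := mul_lt_mul_of_pos_left (hw j hj) ht
  rw [add_sub_right_comm, inner_add_left, inner_add_left, real_inner_smul_left,
    real_inner_smul_left]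
  linarith

/-- For almost every `z` the point `ρ • x + σ • z` avoids the tie hyperplanes, so its membership in
`A i` is stable under small changes of `x`. -/
theorem IsMaxPartition.continuous_ornsteinUhlenbeck (h : IsMaxPartition A y v)
    (hv : Function.Injective v) {i : Fin k} (hm : MeasurableSet (A i)) {ρ : ℝ} (h1 : -1 < ρ)
    (h2 : ρ < 1) : Continuous (ornsteinUhlenbeck ρ ((A i).indicator fun _ => (1 : ℝ))) := by
  set σ := Real.sqrt (1 - ρ ^ 2) with hσ
  have hσ0 : σ ≠ 0 := (sqrt_one_sub_sq_pos h1 h2).ne'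
  refine continuous_iff_continuousAt.2 fun x => ?_
  unfold ContinuousAt
  rw [funext (ornsteinUhlenbeck_indicator hm)]
  have hmeas : ∀ x, MeasurableSet {z | ρ • x + σ • z ∈ A i} := fun x =>
    measurableSet_preimage (by fun_prop) hm
  refine tendsto_measureReal_of_ae_eventually hmeas (hmeas x) ?_
  have hae : ∀ᵐ z ∂(stdGaussian (EuclideanSpace ℝ (Fin n))), ∀ j, j ≠ i →
      ⟪ρ • x - y + σ • z, v j - v i⟫ ≠ 0 := by
    refine ae_all_iff.2 fun j => ?_
    by_cases hj : j = i
    · simp [hj]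
    · filter_upwards [ae_inner_add_smul_ne (sub_ne_zero.2 (hv.ne hj)) hσ0 (ρ • x - y)] with z hz _
      exact hz
  filter_upwards [hae] with z hz
  simp only [h i]
  have hc : ∀ j, Continuous fun x' : EuclideanSpace ℝ (Fin n) => ⟪ρ • x' + σ • z - y, v j⟫ :=
    fun j => by fun_prop
  by_cases hall : ∀ j, ⟪ρ • x + σ • z - y, v j⟫ ≤ ⟪ρ • x + σ • z - y, v i⟫
  · have : ∀ j, ∀ᶠ x' in 𝓝 x, ⟪ρ • x' + σ • z - y, v j⟫ ≤ ⟪ρ • x' + σ • z - y, v i⟫ := by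
      intro j
      by_cases hj : j = i
      · simp [hj]
      have hlt : ⟪ρ • x + σ • z - y, v j⟫ < ⟪ρ • x + σ • z - y, v i⟫ := by
        refine lt_of_le_of_ne (hall j) fun heq => hz j hj ?_
        rw [inner_sub_right, sub_add_eq_add_sub, heq, sub_self]
      exact ((hc j).continuousAt.eventually_lt (hc i).continuousAt hlt).mono fun _ h => h.le
    filter_upwards [Filter.eventually_all.2 this] with x' hx'
    exact iff_of_true hx' hall
  · push Not at hall
    obtain ⟨j, hj⟩ := hall
    filter_upwards [(hc i).continuousAt.eventually_lt (hc j).continuousAt hj] with x' hx'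
    exact iff_of_false (fun h => (h j).not_gt hx') (fun h => (h j).not_gt hj)

/-- Far out in the relative interior of a common face, the part `A i` looks like a half-space. -/
theorem IsMaxPartition.tendsto_atTop (h : IsMaxPartition A y v) {i j : Fin k}
    (hm : MeasurableSet (A i)) {z₀ : EuclideanSpace ℝ (Fin n)} (hz : ⟪z₀, v i⟫ = ⟪z₀, v j⟫)
    (hl : ∀ l, l ≠ i → l ≠ j → ⟪z₀, v l⟫ < ⟪z₀, v i⟫) (b : EuclideanSpace ℝ (Fin n)) (σ : ℝ) :
    Filter.Tendsto (fun t : ℝ => (stdGaussian (EuclideanSpace ℝ (Fin n))).real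
      {z | b + t • z₀ + σ • z ∈ A i}) Filter.atTop
      (𝓝 ((stdGaussian (EuclideanSpace ℝ (Fin n))).real
        {z | ⟪b - y + σ • z, v j⟫ ≤ ⟪b - y + σ • z, v i⟫})) := by
  refine tendsto_measureReal_of_ae_eventually (fun t => measurableSet_preimage (by fun_prop) hm)
    (measurableSet_le (by fun_prop) (by fun_prop)) (Filter.Eventually.of_forall fun z => ?_)
  have hin : ∀ (t : ℝ) u, ⟪b + t • z₀ + σ • z - y, u⟫ = ⟪b - y + σ • z, u⟫ + t * ⟪z₀, u⟫ := by
    intro t u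
    rw [← real_inner_smul_left, ← inner_add_left]
    congr 1
    abel
  have hev : ∀ l, ∀ᶠ t : ℝ in Filter.atTop, l ≠ i → l ≠ j →
      ⟪b - y + σ • z, v l⟫ + t * ⟪z₀, v l⟫ ≤ ⟪b - y + σ • z, v i⟫ + t * ⟪z₀, v i⟫ := by
    intro l
    by_cases hli : l = i
    · simp [hli]
    by_cases hlj : l = j
    · simp [hlj]
    have hlim : Filter.Tendsto (fun t : ℝ => t * (⟪z₀, v i⟫ - ⟪z₀, v l⟫)) Filter.atTop
        Filter.atTop := Filter.tendsto_id.atTop_mul_const (sub_pos.2 (hl l hli hlj))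
    filter_upwards [hlim.eventually_ge_atTop (⟪b - y + σ • z, v l⟫ - ⟪b - y + σ • z, v i⟫)]
      with t ht _ _
    linarith
  filter_upwards [Filter.eventually_all.2 hev] with t ht
  simp only [h i, hin]
  constructor
  · intro h'
    have := h' j
    rw [hz] at this
    linarith
  · intro h' l
    by_cases hli : l = i
    · rw [hli]
    by_cases hlj : l = j
    · rw [hlj, hz]
      linarith
    · exact ht l hli hlj

/-- In the direction opposite to a common face, the part `A i` disappears. -/
theorem IsMaxPartition.tendsto_atBot (h : IsMaxPartition A y v) {i l : Fin k}
    (hm : MeasurableSet (A i)) {z₀ : EuclideanSpace ℝ (Fin n)}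
    (hl : ⟪z₀, v l⟫ < ⟪z₀, v i⟫) (b : EuclideanSpace ℝ (Fin n)) (σ : ℝ) :
    Filter.Tendsto (fun t : ℝ => (stdGaussian (EuclideanSpace ℝ (Fin n))).real
      {z | b + t • z₀ + σ • z ∈ A i}) Filter.atBot (𝓝 0) := by
  rw [← measureReal_empty (μ := stdGaussian (EuclideanSpace ℝ (Fin n)))]
  refine tendsto_measureReal_of_ae_eventually (fun t => measurableSet_preimage (by fun_prop) hm)
    .empty (Filter.Eventually.of_forall fun z => ?_)
  have hlim : Filter.Tendsto (fun t : ℝ => t * (⟪z₀, v i⟫ - ⟪z₀, v l⟫)) Filter.atBot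
      Filter.atBot := Filter.tendsto_id.atBot_mul_const (sub_pos.2 hl)
  filter_upwards [hlim.eventually_lt_atBot
    (⟪b + σ • z - y, v l⟫ - ⟪b + σ • z - y, v i⟫)] with t ht
  simp only [h i, Set.mem_empty_iff_false, iff_false, not_forall, not_le]
  refine ⟨l, ?_⟩
  rw [show b + t • z₀ + σ • z - y = (b + σ • z - y) + t • z₀ by abel, inner_add_left,
    inner_add_left, real_inner_smul_left, real_inner_smul_left]
  linarith

theorem analyticOnNhd_stdGaussian_line {B : Set (EuclideanSpace ℝ (Fin n))} (hB : MeasurableSet B)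
    (b z₀ : EuclideanSpace ℝ (Fin n)) {σ : ℝ} (hσ : σ ≠ 0) :
    AnalyticOnNhd ℝ (fun t : ℝ => (stdGaussian (EuclideanSpace ℝ (Fin n))).real
      {z | b + t • z₀ + σ • z ∈ B}) Set.univ := by
  have hm : MeasurableSet {z | b + σ • z ∈ B} := measurableSet_preimage (by fun_prop) hB
  convert! analyticOnNhd_stdGaussian_translate hm (σ⁻¹ • z₀) using 5 with t z
  simp only [Set.mem_ofPred_eq]
  rw [smul_add, smul_comm t, smul_inv_smul₀ hσ, add_assoc]

/-- If the first variation vanishes on a common face, then the hyperplane through that face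
contains the origin, and the first variation is zero. -/
theorem IsMaxPartition.adjacent_eq (h : IsMaxPartition A y v) (hm : ∀ i, MeasurableSet (A i))
    {ρ : ℝ} (h1 : -1 < ρ) (h2 : ρ < 1) (h0 : ρ ≠ 0) {i j : Fin k}
    (hconst : ∀ x ∈ A i ∩ A j, stabilityGap ρ A i j x = stabilityGap ρ A i j y)
    {z₀ : EuclideanSpace ℝ (Fin n)} (hz : ⟪z₀, v i⟫ = ⟪z₀, v j⟫)
    (hl : ∀ l, l ≠ i → l ≠ j → ⟪z₀, v l⟫ < ⟪z₀, v i⟫) (hex : ∃ l, l ≠ i ∧ l ≠ j) :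
    ornsteinUhlenbeck ρ ((A i).indicator fun _ => (1 : ℝ)) y =
      ornsteinUhlenbeck ρ ((A j).indicator fun _ => (1 : ℝ)) y ∧ ⟪y, v i⟫ = ⟪y, v j⟫ := by
  set γ := stdGaussian (EuclideanSpace ℝ (Fin n))
  set σ := Real.sqrt (1 - ρ ^ 2) with hσ
  have hσ0 : σ ≠ 0 := (sqrt_one_sub_sq_pos h1 h2).ne'
  -- The parameter is `t = ρ * s`: the ray covers a half-line on one side of 0 according to the sign
  -- of `ρ`, and analyticity then handles both signs alike.
  set Φ : ℝ → ℝ := fun t => γ.real {z | ρ • y + t • z₀ + σ • z ∈ A i} -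
    γ.real {z | ρ • y + t • z₀ + σ • z ∈ A j} with hΦ
  have hgap : ∀ s : ℝ, stabilityGap ρ A i j (y + s • z₀) = Φ (ρ * s) := by
    intro s
    rw [stabilityGap, ornsteinUhlenbeck_indicator (hm i), ornsteinUhlenbeck_indicator (hm j)]
    simp only [hΦ, smul_add, smul_smul, hσ]
    rfl
  have hray : ∀ s : ℝ, 0 ≤ s → Φ (ρ * s) = stabilityGap ρ A i j y := by
    intro s hs
    rw [← hgap]
    have hmax : ∀ l, ⟪z₀, v l⟫ ≤ ⟪z₀, v i⟫ := by
      intro l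
      by_cases hli : l = i
      · rw [hli]
      by_cases hlj : l = j
      · rw [hlj, hz]
      · exact (hl l hli hlj).le
    refine hconst _ ⟨(h i _).2 fun l => ?_, (h j _).2 fun l => ?_⟩
    · rw [add_sub_cancel_left, real_inner_smul_left, real_inner_smul_left]
      exact mul_le_mul_of_nonneg_left (hmax l) hs
    · rw [add_sub_cancel_left, real_inner_smul_left, real_inner_smul_left, ← hz]
      exact mul_le_mul_of_nonneg_left (hmax l) hs
  have hana : AnalyticOnNhd ℝ Φ Set.univ :=
    (analyticOnNhd_stdGaussian_line (hm i) _ _ hσ0).sub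
      (analyticOnNhd_stdGaussian_line (hm j) _ _ hσ0)
  have hΦc : Φ = fun _ => stabilityGap ρ A i j y := by
    refine hana.eq_of_eventuallyEq (z₀ := ρ * 1) analyticOnNhd_const ?_
    have hpos : ∀ᶠ t in 𝓝 (ρ * 1), 0 < t / ρ := by
      refine ContinuousAt.eventually_lt continuousAt_const (by fun_prop) ?_
      rw [mul_div_cancel_left₀ _ h0]
      exact one_pos
    filter_upwards [hpos] with t ht
    rw [← hray _ ht.le, mul_div_cancel₀ _ h0]
  have hl' : ∀ l, l ≠ j → l ≠ i → ⟪z₀, v l⟫ < ⟪z₀, v j⟫ := fun l hlj hli => hz ▸ hl l hli hlj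
  have htop := (h.tendsto_atTop (hm i) hz hl (ρ • y) σ).sub
    (h.tendsto_atTop (hm j) hz.symm hl' (ρ • y) σ)
  -- A third functional, smaller at `z₀`, overtakes both `v i` and `v j` as `t → -∞`.
  obtain ⟨l, hli, hlj⟩ := hex
  have hbot := (h.tendsto_atBot (hm i) (hl l hli hlj) (ρ • y) σ).sub
    (h.tendsto_atBot (hm j) (hl' l hlj hli) (ρ • y) σ)
  change Filter.Tendsto Φ _ _ at htop hbot
  rw [hΦc] at htop hbot
  have hgap0 := tendsto_nhds_unique hbot tendsto_const_nhds
  have hhalf := tendsto_nhds_unique htop tendsto_const_nhds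
  rw [← hgap0, sub_self] at hhalf
  refine ⟨sub_eq_zero.1 (by rw [sub_self] at hgap0; exact hgap0.symm), ?_⟩
  -- The balanced half-spaces are centred at `ρ • y - y`; dividing by `1 - ρ` leaves the claim about
  -- `y`.
  have := inner_eq_of_stdGaussian_halfspace_eq (sub_eq_zero.1 hhalf)
  rw [inner_sub_left, inner_sub_left, real_inner_smul_left, real_inner_smul_left] at this
  have h3 : (1 - ρ) ≠ 0 := by linarith
  refine mul_left_cancel₀ h3 ?_
  linarith

end Flat

/-! ### Optimality and equality of the volumes -/

section Optimal

variable {n k : ℕ} {A : Fin k → Set (EuclideanSpace ℝ (Fin n))} {a : Fin k → ℝ} {ρ : ℝ}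
  {y : EuclideanSpace ℝ (Fin n)} {v : Fin k → EuclideanSpace ℝ (Fin n)}

theorem IsPartition.sum_volumes (hA : IsPartition A) (ha : HasVolumes A a) : ∑ p, a p = 1 := by
  have h := measure_iUnion₀ (μ := stdGaussian (EuclideanSpace ℝ (Fin n)))
    (fun p q hpq => hA.overlap p q hpq) fun p => (hA.measurable p).nullMeasurableSet
  rw [hA.cover, measure_univ, tsum_fintype] at h
  have h' := congrArg ENNReal.toReal h
  rw [ENNReal.toReal_sum fun p _ => measure_ne_top _ _, ENNReal.toReal_one] at h'
  rw [h']
  exact Finset.sum_congr rfl fun p _ => (ha p).symm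

theorem IsMaxPartition.exists_variation [Nonempty (Fin n)] (h : IsMaxPartition A y v)
    (hv : Function.Injective v) (h1 : -1 < ρ) (h2 : ρ < 1) (hA : IsPartition A)
    (ha : HasVolumes A a) (hne : ∀ i, (strictCell v i).Nonempty) {i j : Fin k} (hij : i ≠ j)
    {x x' : EuclideanSpace ℝ (Fin n)} (hx : x ∈ A i ∩ A j) (hx' : x' ∈ A i ∩ A j) {δ : ℝ}
    (hδ : 0 < δ) :
    ∃ B : Fin k → Set (EuclideanSpace ℝ (Fin n)), IsPartition B ∧ HasVolumes B a ∧
      ∃ g > 0, |noiseStability ρ B - noiseStability ρ A -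
        2 * g * (stabilityGap ρ A i j x - stabilityGap ρ A i j x')| ≤ 8 * δ * g := by
  have hc : Continuous (stabilityGap ρ A i j) :=
    (h.continuous_ornsteinUhlenbeck hv (hA.measurable i) h1 h2).sub
      (h.continuous_ornsteinUhlenbeck hv (hA.measurable j) h1 h2)
  exact NoiseStability.exists_variation h1 h2 hA ha hij (isOpen_translate_strictCell y v j)
    (isOpen_translate_strictCell y v i) (h.translate_strictCell_subset hij.symm)
    (h.translate_strictCell_subset hij) (h.subset_closure (hne j) hx.2)
    (h.subset_closure (hne i) hx'.1) hc.continuousAt hc.continuousAt hδ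

/-- If exchanging mass between two parts cannot increase the noise stability, then the first
variation is constant on their interface. -/
theorem IsMaxPartition.stabilityGap_eq_of_isLUB [Nonempty (Fin n)] (h : IsMaxPartition A y v)
    (hv : Function.Injective v) (h1 : -1 < ρ) (h2 : ρ < 1) (hA : IsPartition A)
    (ha : HasVolumes A a) (hne : ∀ i, (strictCell v i).Nonempty)
    (hopt : IsLUB (stabilityValues n ρ a) (noiseStability ρ A)) {i j : Fin k} (hij : i ≠ j)
    {x x' : EuclideanSpace ℝ (Fin n)} (hx : x ∈ A i ∩ A j) (hx' : x' ∈ A i ∩ A j) :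
    stabilityGap ρ A i j x = stabilityGap ρ A i j x' := by
  have key : ∀ {x x'}, x ∈ A i ∩ A j → x' ∈ A i ∩ A j →
      stabilityGap ρ A i j x ≤ stabilityGap ρ A i j x' := by
    intro x x' hx hx'
    by_contra! hlt
    -- With `δ` an eighth of the difference, the error `8 * δ * g` is half the main term, so the
    -- stability strictly increases.
    obtain ⟨B, hB, hBa, g, hg, hvar⟩ := h.exists_variation (ρ := ρ) hv h1 h2 hA ha hne hij hx hx'
      (δ := (stabilityGap ρ A i j x - stabilityGap ρ A i j x') / 8) (by linarith)
    have hle := hopt.1 ⟨B, hB, hBa, rfl⟩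
    have hpos := mul_pos hg (sub_pos.2 hlt)
    have := (abs_le.1 hvar).1
    linarith
  exact le_antisymm (key hx hx') (key hx' hx)

/-- The same exchange with the roles of the two points reversed strictly decreases the stability. -/
theorem IsMaxPartition.stabilityGap_eq_of_isGLB [Nonempty (Fin n)] (h : IsMaxPartition A y v)
    (hv : Function.Injective v) (h1 : -1 < ρ) (h2 : ρ < 1) (hA : IsPartition A)
    (ha : HasVolumes A a) (hne : ∀ i, (strictCell v i).Nonempty)
    (hopt : IsGLB (stabilityValues n ρ a) (noiseStability ρ A)) {i j : Fin k} (hij : i ≠ j)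
    {x x' : EuclideanSpace ℝ (Fin n)} (hx : x ∈ A i ∩ A j) (hx' : x' ∈ A i ∩ A j) :
    stabilityGap ρ A i j x = stabilityGap ρ A i j x' := by
  have key : ∀ {x x'}, x ∈ A i ∩ A j → x' ∈ A i ∩ A j →
      stabilityGap ρ A i j x ≤ stabilityGap ρ A i j x' := by
    intro x x' hx hx'
    by_contra! hlt
    obtain ⟨B, hB, hBa, g, hg, hvar⟩ := h.exists_variation (ρ := ρ) hv h1 h2 hA ha hne hij hx' hx
      (δ := (stabilityGap ρ A i j x - stabilityGap ρ A i j x') / 8) (by linarith)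
    have hle := hopt.1 ⟨B, hB, hBa, rfl⟩
    have hpos := mul_pos hg (sub_pos.2 hlt)
    have := (abs_le.1 hvar).2
    linarith
  exact le_antisymm (key hx hx') (key hx' hx)

/-- If the first variation is constant on every interface of a flat partition, then all parts have
the same volume. -/
theorem IsMaxPartition.volumes_eq (h : IsMaxPartition A y v) (hm : ∀ i, MeasurableSet (A i))
    (ha : HasVolumes A a) (hne : ∀ i, (strictCell v i).Nonempty) (h1 : -1 < ρ) (h2 : ρ < 1)
    (h0 : ρ ≠ 0) (hk : 2 < k)
    (hconst : ∀ i j, i ≠ j → ∀ x ∈ A i ∩ A j, stabilityGap ρ A i j x = stabilityGap ρ A i j y)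
    (p q : Fin k) : a p = a q := by
  have hσ : 0 < Real.sqrt (1 - ρ ^ 2) := sqrt_one_sub_sq_pos h1 h2
  -- Both invariants travel together as a pair along chains of adjacent cells.
  have hall : ∀ p q, (fun i => (ornsteinUhlenbeck ρ ((A i).indicator fun _ => (1 : ℝ)) y,
      ⟪y, v i⟫)) p = (fun i => (ornsteinUhlenbeck ρ ((A i).indicator fun _ => (1 : ℝ)) y,
      ⟪y, v i⟫)) q := by
    refine eq_of_adjacent_eq hne _ fun i j z hij hz hl => ?_
    have hex : ∃ l, l ≠ i ∧ l ≠ j := by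
      obtain ⟨l, hl⟩ := Finset.exists_mem_notMem_of_card_lt_card (s := {i, j})
        (t := (Finset.univ : Finset (Fin k))) (by
          rw [Finset.card_univ, Fintype.card_fin]
          exact Finset.card_le_two.trans_lt hk)
      exact ⟨l, by simpa using hl.2⟩
    exact Prod.ext_iff.2 (h.adjacent_eq hm h1 h2 h0 (hconst i j hij) hz hl hex)
  -- As all `⟪y, v j⟫` coincide, shifts by multiples of `y` cancel from the defining inequalities,
  -- and the positive factor `√(1 - ρ²)` scales out.
  have hvol : ∀ p, ornsteinUhlenbeck ρ ((A p).indicator fun _ => (1 : ℝ)) y = a p := by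
    intro p
    rw [ornsteinUhlenbeck_indicator (hm p), ← ha p]
    congr 1
    ext z
    simp only [Set.mem_ofPred_eq, h p]
    refine forall_congr' fun j => ?_
    have hy : ⟪y, v j⟫ = ⟪y, v p⟫ := congrArg Prod.snd (hall j p)
    simp only [inner_sub_left, inner_add_left, real_inner_smul_left, hy]
    simp only [sub_le_sub_iff_right, add_le_add_iff_left]
    exact mul_le_mul_iff_right₀ hσ
  rw [← hvol p, ← hvol q]
  exact congrArg Prod.fst (hall p q)

theorem IsFlatPartition.exists_isMaxPartition (hA : IsFlatPartition A) :
    ∃ y v, IsMaxPartition A y v ∧ Function.Injective v := by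
  obtain ⟨-, y, v, -, hv, hAv⟩ := hA
  refine ⟨y, v, fun i x => ?_, fun i j hij => ?_⟩
  · rw [hAv i]
    constructor
    · rintro ⟨x, hx, rfl⟩ j
      rw [add_sub_cancel_left]
      exact hx j
    · exact fun hx => ⟨x - y, hx, add_sub_cancel _ _⟩
  · by_contra h
    exact hv i j h ⟨1, one_pos, by rw [hij, one_smul]⟩

/-- The nonzero vectors `w` and `N` are orthogonal. Dimension at least 2 gives at least three parts,
as the limit argument along an interface requires. -/
theorem GeometricAssumption.one_lt {i j : Fin k} {N w : EuclideanSpace ℝ (Fin n)} {c : ℝ}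
    (h : GeometricAssumption A i j N c w) : 1 < n := by
  have hw : ⟪w, N⟫ = 0 := by
    have h0 := h.line_subset 0
    have h1 := h.line_subset 1
    rw [inner_add_left, real_inner_smul_left _ N] at h0 h1
    simp only [zero_smul, inner_zero_left, one_smul] at h0 h1
    linarith
  have hN : N ≠ 0 := by
    rintro rfl
    simpa using h.norm_normal
  by_contra! hn
  have hrank : Module.finrank ℝ (EuclideanSpace ℝ (Fin n)) ≤ 1 := by simpa using hn
  obtain ⟨u, hu⟩ := finrank_le_one_iff.1 hrank
  obtain ⟨s, rfl⟩ := hu w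
  obtain ⟨t, rfl⟩ := hu N
  have hs := (smul_ne_zero_iff.1 h.direction_ne)
  have ht := (smul_ne_zero_iff.1 hN)
  rw [real_inner_smul_left, real_inner_smul_right, mul_eq_zero, mul_eq_zero] at hw
  rcases hw with hw | hw | hw
  · exact hs.1 hw
  · exact ht.1 hw
  · exact hs.2 (inner_self_eq_zero.1 hw)

end Optimal

end NoiseStability

theorem mainTheorem2 (n : ℕ) (A : Fin (n + 1) → Set (EuclideanSpace ℝ (Fin n)))
    (a : Fin (n + 1) → ℝ)
    (hA : NoiseStability.IsPartition A)
    (hvol : NoiseStability.HasVolumes A a)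
    (hpos : ∀ p, 0 < a p) :
    (∀ ρ : ℝ, 0 < ρ → ρ < 1 →
      IsLUB (NoiseStability.stabilityValues n ρ a) (NoiseStability.noiseStability ρ A) →
      (∃ i j N c w, NoiseStability.GeometricAssumption A i j N c w) →
      ∀ p, a p = 1 / ((n : ℝ) + 1)) ∧
    (∀ ρ : ℝ, -1 < ρ → ρ < 0 →
      IsGLB (NoiseStability.stabilityValues n ρ a) (NoiseStability.noiseStability ρ A) →
      (∃ i j N c w, NoiseStability.GeometricAssumption A i j N c w) →
      ∀ p, a p = 1 / ((n : ℝ) + 1)) := by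
  have hfin : (∀ p q, a p = a q) → ∀ p, a p = 1 / ((n : ℝ) + 1) := by
    intro heq p
    have hsum := hA.sum_volumes hvol
    rw [Finset.sum_congr rfl fun q _ => heq q p, Finset.sum_const, Finset.card_univ,
      Fintype.card_fin, nsmul_eq_mul] at hsum
    push_cast at hsum
    rw [eq_div_iff (by positivity), mul_comm]
    exact hsum
  constructor
  · rintro ρ h0 h2 hopt ⟨i, j, N, c, w, hG⟩
    have h1 : -1 < ρ := by linarith
    have hn := hG.one_lt
    have : Nonempty (Fin n) := ⟨⟨0, by omega⟩⟩
    obtain ⟨y, v, h, hv⟩ := hG.flat.exists_isMaxPartition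
    have hne : ∀ i, (NoiseStability.strictCell v i).Nonempty := fun i =>
      h.strictCell_nonempty hv ((hvol i).symm ▸ hpos i)
    -- The apex lies on every interface, so it can serve as the common reference point for the gaps.
    have hy : ∀ i, y ∈ A i := fun i => (h i y).2 fun j => by simp
    exact hfin (h.volumes_eq hA.measurable hvol hne h1 h2 h0.ne' (by omega) fun i j hij x hx =>
      h.stabilityGap_eq_of_isLUB hv h1 h2 hA hvol hne hopt hij hx ⟨hy i, hy j⟩)
  · rintro ρ h1 h0 hopt ⟨i, j, N, c, w, hG⟩
    have h2 : ρ < 1 := by linarith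
    have hn := hG.one_lt
    have : Nonempty (Fin n) := ⟨⟨0, by omega⟩⟩
    obtain ⟨y, v, h, hv⟩ := hG.flat.exists_isMaxPartition
    have hne : ∀ i, (NoiseStability.strictCell v i).Nonempty := fun i =>
      h.strictCell_nonempty hv ((hvol i).symm ▸ hpos i)
    have hy : ∀ i, y ∈ A i := fun i => (h i y).2 fun j => by simp
    exact hfin (h.volumes_eq hA.measurable hvol hne h1 h2 h0.ne (by omega) fun i j hij x hx =>
      h.stabilityGap_eq_of_isGLB hv h1 h2 hA hvol hne hopt hij hx ⟨hy i, hy j⟩)
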